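/- Let $k$ be a field and $n\ge 0$. Let $\Gamma$ be the Hasse graph of the lattice of subsets of $\{1,\dots,n\}$: its vertices are the subsets $A$, and for every $A$ and every $i\in A$ there is one edge from $A$ to $A\setminus\{i\}$. For a path $\pi=(e_1,\dots,e_m)$ in $\Gamma$ and $1\le j\le m$ put $e(\pi,j)=\sum_{1\le i_1<\cdots<i_j\le m}e_{i_1}\cdots e_{i_j}$ in the free associative $k$-algebra $T(E)$ on the set $E$ of edges. Let $Q_n=A(\Gamma)=T(E)/R$, where $R$ is the two-sided ideal generated by all $e(\pi_1,j)-e(\pi_2,j)$ with $\pi_1,\pi_2$ paths having the same starting vertex and the same end vertex and $1\le j\le$ the length of $\pi_1$. Let $(Q_n)_{[d]}$ be the image in $Q_n$ of the span of the words of length $d$ in the edges. A permutation $\sigma\in S_n$ acts on $Q_n$ by the algebra automorphism sending the edge $A\to A\setminus\{i\}$ to the edge $\sigma(A)\to\sigma(A)\setminus\{\sigma(i)\}$, and it preserves every $(Q_n)_{[d]}$. Theorem. Every $(Q_n)_{[d]}$ is finite-dimensional. Let $\sigma\in S_n$ have cycle lengths $i_1,\dots,i_m$ (fixed points included as cycles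 of length $1$, so that $i_1+\cdots+i_m=n$). Then, in $k[[t]]$, $$Tr_\sigma(Q_n,t):=\sum_{d\ge 0}\mathrm{Tr}\bigl(\sigma|_{(Q_n)_{[d]}}\bigr)\,t^d=\frac{1-t}{1-t\prod_{j=1}^m(2-t^{i_j})}.$$ For $\sigma=\mathrm{id}$ the right-hand side is $\frac{1-t}{1-t(2-t)^n}$, which is the Hilbert series of $Q_n$: in $\mathbb{Q}[[t]]$, $$\sum_{d\ge 0}\dim_k (Q_n)_{[d]}\,t^d=\frac{1-t}{1-t(2-t)^n}.$$ -/

import Mathlib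

/-- A directed layered graph: every edge goes down by exactly one level, there is exactly one
vertex `*` of level `0`, the levels are bounded, and every vertex of positive level is the tail
of some edge. -/
structure LayeredGraph where
  /-- the vertices -/
  V : Type
  /-- the edges -/
  E : Type
  tail : E → V
  head : E → V
  level : V → ℕ
  level_tail : ∀ e, level (tail e) = level (head e) + 1
  existsUnique_level_zero : ∃! v, level v = 0
  exists_bound : ∃ N, ∀ v, level v ≤ N
  exists_edge : ∀ v, 0 < level v → ∃ e, tail e = v

namespace LayeredGraph

/-- `Γ.IsPath v π w`: the list of edges `π` is a path from `v` to `w`. -/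
def IsPath (Γ : LayeredGraph) : Γ.V → List Γ.E → Γ.V → Prop
  | v, [], w => v = w
  | v, e :: π, w => Γ.tail e = v ∧ Γ.IsPath (Γ.head e) π w

/-- For `π = (e₁, …, e_m)`, the element
`e(π, j) = ∑_{1 ≤ i₁ < ⋯ < i_j ≤ m} e_{i₁} ⋯ e_{i_j}` of the free algebra `T(E)`. -/
noncomputable def pathElem (k : Type*) [Field k] (Γ : LayeredGraph) (π : List Γ.E) (j : ℕ) :
    FreeAlgebra k Γ.E :=
  ((π.sublistsLen j).map fun l => (l.map (FreeAlgebra.ι k)).prod).sum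

/-- The defining relations of `A(Γ)`: `e(π₁, j) = e(π₂, j)` whenever `π₁` and `π₂` are paths with
the same starting vertex and the same end vertex, `1 ≤ j ≤ length π₁`. -/
inductive Rel (k : Type*) [Field k] (Γ : LayeredGraph) :
    FreeAlgebra k Γ.E → FreeAlgebra k Γ.E → Prop
  | mk (v w : Γ.V) (π₁ π₂ : List Γ.E) (h₁ : Γ.IsPath v π₁ w) (h₂ : Γ.IsPath v π₂ w)
      (j : ℕ) (hj : 1 ≤ j) (hj' : j ≤ π₁.length) :
      Rel k Γ (pathElem k Γ π₁ j) (pathElem k Γ π₂ j)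

/-- The algebra `A(Γ) = T(E)/R`, the quotient of the free algebra on the edges by the two-sided
ideal generated by the relations. -/
abbrev Alg (k : Type*) [Field k] (Γ : LayeredGraph) : Type _ := RingQuot (Rel k Γ)

/-- The class of an edge in `A(Γ)`. -/
noncomputable def edge (k : Type*) [Field k] (Γ : LayeredGraph) (e : Γ.E) : Alg k Γ :=
  RingQuot.mkAlgHom k (Rel k Γ) (FreeAlgebra.ι k e)

/-- The homogeneous component `A(Γ)_[d]`: the image of the span of the words of length `d` in the
edges. -/
noncomputable def component (k : Type*) [Field k] (Γ : LayeredGraph) (d : ℕ) :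
    Submodule k (Alg k Γ) :=
  Submodule.span k {x | ∃ l : List Γ.E, l.length = d ∧ (l.map (edge k Γ)).prod = x}

/-- Automorphisms of a layered graph: level-preserving permutations of the vertices together with
compatible permutations of the edges. -/
structure Aut (Γ : LayeredGraph) where
  onV : Γ.V ≃ Γ.V
  onE : Γ.E ≃ Γ.E
  tail_onE : ∀ e, Γ.tail (onE e) = onV (Γ.tail e)
  head_onE : ∀ e, Γ.head (onE e) = onV (Γ.head e)
  level_onV : ∀ v, Γ.level (onV v) = Γ.level v

theorem Aut.isPath_map {Γ : LayeredGraph} (φ : Γ.Aut) (π : List Γ.E) (v w : Γ.V)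
    (h : Γ.IsPath v π w) : Γ.IsPath (φ.onV v) (π.map φ.onE) (φ.onV w) := by
  induction π generalizing v with
  | nil => exact congrArg φ.onV h
  | cons e π ih =>
    refine ⟨by rw [φ.tail_onE, h.1], ?_⟩
    rw [φ.head_onE]
    exact ih _ h.2

theorem Aut.lift_pathElem {k : Type*} [Field k] {Γ : LayeredGraph} (φ : Γ.Aut) (π : List Γ.E)
    (j : ℕ) :
    FreeAlgebra.lift k (fun e => edge k Γ (φ.onE e)) (pathElem k Γ π j) =
      RingQuot.mkAlgHom k (Rel k Γ) (pathElem k Γ (π.map φ.onE) j) := by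
  have hs : (π.map φ.onE).sublistsLen j = (π.sublistsLen j).map (List.map φ.onE) := by
    induction π generalizing j with
    | nil => cases j <;> simp
    | cons e π ih =>
      cases j with
      | zero => simp
      | succ j => simp [List.sublistsLen_succ_cons, ih, Function.comp_def]
  simp only [pathElem, hs, map_list_sum, List.map_map]
  congr 1
  refine List.map_congr_left fun l _ => ?_
  simp [Function.comp_def, map_list_prod, edge]

/-- The algebra endomorphism of `A(Γ)` induced by a graph automorphism: it sends the class of an
edge `e` to the class of `φ(e)`. -/
noncomputable def Aut.algHom (k : Type*) [Field k] {Γ : LayeredGraph} (φ : Γ.Aut) :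
    Alg k Γ →ₐ[k] Alg k Γ :=
  RingQuot.liftAlgHom k
    ⟨FreeAlgebra.lift k (fun e => edge k Γ (φ.onE e)), by
      rintro _ _ ⟨v, w, π₁, π₂, h₁, h₂, j, hj, hj'⟩
      rw [φ.lift_pathElem, φ.lift_pathElem]
      exact RingQuot.mkAlgHom_rel k (Rel.mk _ _ _ _ (φ.isPath_map _ _ _ h₁)
        (φ.isPath_map _ _ _ h₂) j hj (by simpa using hj'))⟩

theorem Aut.algHom_edge {k : Type*} [Field k] {Γ : LayeredGraph} (φ : Γ.Aut) (e : Γ.E) :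
    φ.algHom k (edge k Γ e) = edge k Γ (φ.onE e) := by
  simp [Aut.algHom, edge]

theorem Aut.algHom_mem_component {k : Type*} [Field k] {Γ : LayeredGraph} (φ : Γ.Aut) (d : ℕ) :
    ∀ x ∈ component k Γ d, (φ.algHom k).toLinearMap x ∈ component k Γ d := by
  intro x hx
  refine Submodule.span_induction ?_ ?_ ?_ ?_ hx
  · rintro _ ⟨l, hl, rfl⟩
    refine Submodule.subset_span ⟨l.map φ.onE, by simpa using hl, ?_⟩
    simp [map_list_prod, Function.comp_def, Aut.algHom_edge]
  · simp
  · intro a b _ _ ha hb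
    rw [map_add]
    exact Submodule.add_mem _ ha hb
  · intro c a _ ha
    rw [map_smul]
    exact Submodule.smul_mem _ c ha

/-- The action of a graph automorphism on the homogeneous component `A(Γ)_[d]`. -/
noncomputable def Aut.onComponent (k : Type*) [Field k] {Γ : LayeredGraph} (φ : Γ.Aut) (d : ℕ) :
    component k Γ d →ₗ[k] component k Γ d :=
  (φ.algHom k).toLinearMap.restrict (φ.algHom_mem_component d)

/-- The graded trace `Tr_φ(A(Γ), t) = ∑_d Tr(φ | A(Γ)_[d]) t^d`. -/
noncomputable def gradedTrace (k : Type*) [Field k] (Γ : LayeredGraph) (φ : Γ.Aut) :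
    PowerSeries k :=
  PowerSeries.mk fun d => LinearMap.trace k (component k Γ d) (φ.onComponent k d)

/-- The Hilbert series `H(A(Γ), t) = ∑_d dim A(Γ)_[d] t^d`. -/
noncomputable def hilbertSeries (k : Type*) [Field k] (Γ : LayeredGraph) : PowerSeries ℚ :=
  PowerSeries.mk fun d => (Module.finrank k (component k Γ d) : ℚ)

end LayeredGraph

/-- The Hasse graph of the lattice of subsets of an `n`-element set: the vertices are the subsets
`A`, of level `|A|`, and for each `i ∈ A` there is one edge from `A` to `A \ {i}`. -/
def subsetGraph (n : ℕ) : LayeredGraph where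
  V := Finset (Fin n)
  E := {p : Finset (Fin n) × Fin n // p.2 ∈ p.1}
  tail p := p.1.1
  head p := p.1.1.erase p.1.2
  level A := A.card
  level_tail p := (Finset.card_erase_add_one p.2).symm
  existsUnique_level_zero := ⟨∅, rfl, fun _ h => Finset.card_eq_zero.1 h⟩
  exists_bound := ⟨n, fun A => by simpa using Finset.card_le_univ A⟩
  exists_edge A hA := by
    obtain ⟨i, hi⟩ := Finset.card_pos.1 hA
    exact ⟨⟨(A, i), hi⟩, rfl⟩

/-- The automorphism of the graph of subsets given by a permutation `σ`: it sends `A` to `σ(A)`,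
and the edge from `A` to `A \ {i}` to the edge from `σ(A)` to `σ(A) \ {σ(i)}`. -/
def subsetGraphAut {n : ℕ} (σ : Equiv.Perm (Fin n)) : (subsetGraph n).Aut where
  onV := σ.finsetCongr
  onE := (σ.finsetCongr.prodCongr σ).subtypeEquiv fun p => by simp
  tail_onE _ := rfl
  head_onE p := (Finset.map_erase σ.toEmbedding p.1.1 p.1.2).symm
  level_onV A := Finset.card_map σ.toEmbedding (s := A)

/-- The algebra `Q_n`. -/
abbrev Qn (k : Type*) [Field k] (n : ℕ) : Type _ := LayeredGraph.Alg k (subsetGraph n)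

/-! For a vertex `v`, let $P_v(t)=\sum_i e(\pi,i)t^i$ for any path $\pi$ from `v` to the bottom
vertex. A path is encoded by the product of the factors $1+et$ over its edges, so the relations of
$A(\Gamma)$ say that these products depend only on the endpoints. Hence for $u<v$ the quotient
$P_vP_u^{-1}$ is a polynomial of degree at most $\rho(v)-\rho(u)$. On the letters $(v,i)$, standing
for the coefficients of $P_v$, this is the vanishing of the remainder of $P_v$ divided by $P_u$. Its
coefficients serve as rules rewriting $(v,i)(u,j)$ when $u<v$ and $i=\rho(v)-\rho(u)$.

A suitable weight of letters makes the rules strictly decreasing (`system_decreasing`). Overlaps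
come from chains $x<u<v$ and are resolved by comparing the divisions of $P_v$ by $P_u$, $P_u$ by
$P_x$ and $P_v$ by $P_x$ (`system_resolvable`). A diamond lemma (`nf_rel`) then makes the
irreducible words independent modulo the rules. Homomorphisms between $A(\Gamma)$ and the rewriting
quotient (`letterHom`, `toLetterAlg`) carry this over to a basis of every component
(`componentBasis`).

Graph automorphisms preserve rank and order, so they permute this basis, and the trace counts
irreducible words all of whose letters are fixed. For subsets, the fixed vertices are the unions of
cycles of `σ`. Let $H$ count all fixed irreducible words and $Y_A$ those starting at $A$. Removing
the first letter gives, for every fixed $A$, $\sum_{B\subseteq A}t^{|A|-|B|}Y_B=(t+\cdots+t^{|A|})H$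
over the fixed $B$. Since $\prod((1-t^{s})+t^{s})=1$, this is solved by $(1-t)Y_A=tH\prod(1-t^{s})$
for $A\ne\emptyset$, over the cycle lengths $s$ in $A$, and $Y_\emptyset=0$. Inserting this in
$H=1+\sum_A Y_A$ gives the formula. -/

/-- The data of a rewriting system on the free algebra on a set `L` of letters: a word `ab` of
length two with `red a b` is to be replaced by `rhs a b`. Letters have a degree and a weight. -/
structure QuadraticRewriting (k L : Type*) [Field k] where
  red : L → L → Prop
  rhs : L → L → FreeAlgebra k L
  deg : L → ℕ
  weight : L → ℕ

/-! ### Quadratic rewriting in a free algebra and the diamond lemma. -/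

namespace QuadraticRewriting

variable {k L : Type*} [Field k]

/-- The monomial of a word. -/
noncomputable def mon (k : Type*) {L : Type*} [Field k] (l : List L) : FreeAlgebra k L :=
  (l.map (FreeAlgebra.ι k)).prod

@[simp] theorem mon_nil : mon k ([] : List L) = 1 := rfl

theorem mon_append (l l' : List L) : mon k (l ++ l') = mon k l * mon k l' := by
  simp [mon]

theorem mon_cons (a : L) (l : List L) : mon k (a :: l) = mon k [a] * mon k l := by
  simp [mon]

theorem mon_singleton (a : L) : mon k [a] = FreeAlgebra.ι k a := by
  simp [mon]

theorem basisFreeMonoid_apply (l : List L) :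
    FreeAlgebra.basisFreeMonoid k L (FreeMonoid.ofList l) = mon k l := by
  have : FreeAlgebra.basisFreeMonoid k L (FreeMonoid.ofList l) =
      FreeAlgebra.equivMonoidAlgebraFreeMonoid.symm
        (MonoidAlgebra.single (FreeMonoid.ofList l) (1 : k)) := by
    simp [FreeAlgebra.basisFreeMonoid]
  rw [this]
  simp [FreeAlgebra.equivMonoidAlgebraFreeMonoid, mon, FreeMonoid.lift_apply]

/-- The linear endomorphism with prescribed values on monomials. -/
noncomputable def ofWords {M : Type*} [AddCommGroup M] [Module k M] (g : List L → M) :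
    FreeAlgebra k L →ₗ[k] M :=
  (FreeAlgebra.basisFreeMonoid k L).constr k fun m => g m.toList

@[simp] theorem ofWords_mon {M : Type*} [AddCommGroup M] [Module k M] (g : List L → M)
    (l : List L) : ofWords (k := k) g (mon k l) = g l := by
  rw [← basisFreeMonoid_apply, ofWords, Module.Basis.constr_basis]
  rfl

theorem span_range_mon : Submodule.span k (Set.range (mon k : List L → FreeAlgebra k L)) = ⊤ := by
  rw [← (FreeAlgebra.basisFreeMonoid k L).span_eq]
  congr 1
  ext x
  constructor
  · rintro ⟨l, rfl⟩
    exact ⟨_, basisFreeMonoid_apply l⟩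
  · rintro ⟨l, rfl⟩
    exact ⟨l.toList, (basisFreeMonoid_apply _).symm⟩

variable (S : QuadraticRewriting k L)

/-- The degree of a word. -/
def wdeg (l : List L) : ℕ := (l.map S.deg).sum

/-- The weight of a word. -/
def wwt (l : List L) : ℕ := (l.map S.weight).sum

@[simp] theorem wdeg_nil : S.wdeg [] = 0 := rfl
@[simp] theorem wwt_nil : S.wwt [] = 0 := rfl
@[simp] theorem wdeg_cons (a : L) (l : List L) : S.wdeg (a :: l) = S.deg a + S.wdeg l := by
  simp [wdeg]
@[simp] theorem wwt_cons (a : L) (l : List L) : S.wwt (a :: l) = S.weight a + S.wwt l := by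
  simp [wwt]
@[simp] theorem wdeg_append (l l' : List L) : S.wdeg (l ++ l') = S.wdeg l + S.wdeg l' := by
  simp [wdeg]
@[simp] theorem wwt_append (l l' : List L) : S.wwt (l ++ l') = S.wwt l + S.wwt l' := by
  simp [wwt]

/-- The span of the words of degree `d` and of weight at most `r`. -/
def fil (d r : ℕ) : Submodule k (FreeAlgebra k L) :=
  Submodule.span k (mon k '' {l | S.wdeg l = d ∧ S.wwt l ≤ r})

theorem mon_mem_fil {l : List L} {d r : ℕ} (h : S.wdeg l = d) (h' : S.wwt l ≤ r) :
    mon k l ∈ S.fil d r :=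
  Submodule.subset_span ⟨l, ⟨h, h'⟩, rfl⟩

theorem fil_mono {d r r' : ℕ} (h : r ≤ r') : S.fil d r ≤ S.fil d r' :=
  Submodule.span_mono (Set.image_mono fun _ hl => ⟨hl.1, hl.2.trans h⟩)

theorem mul_mem_fil {d d' r r' : ℕ} {x y : FreeAlgebra k L} (hx : x ∈ S.fil d r)
    (hy : y ∈ S.fil d' r') : x * y ∈ S.fil (d + d') (r + r') := by
  have := Submodule.mul_mem_mul hx hy
  rw [fil, fil, Submodule.span_mul_span] at this
  refine Submodule.span_mono ?_ this
  rintro _ ⟨_, ⟨l, hl, rfl⟩, _, ⟨l', hl', rfl⟩, rfl⟩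
  refine ⟨l ++ l', ⟨?_, ?_⟩, mon_append l l'⟩
  · rw [wdeg_append, hl.1, hl'.1]
  · rw [wwt_append]
    exact add_le_add hl.2 hl'.2

/-- The span of the consequences `p (ab - rhs a b) q` of the rewriting rules for which the word
`p a b q` has weight at most `r`. -/
def relSpan (r : ℕ) : Submodule k (FreeAlgebra k L) :=
  Submodule.span k {x | ∃ p a b q, S.red a b ∧ S.wwt (p ++ a :: b :: q) ≤ r ∧
    mon k p * (mon k [a, b] - S.rhs a b) * mon k q = x}

theorem relSpan_mono {r r' : ℕ} (h : r ≤ r') : S.relSpan r ≤ S.relSpan r' :=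
  Submodule.span_mono fun _ ⟨p, a, b, q, h₁, h₂, h₃⟩ => ⟨p, a, b, q, h₁, h₂.trans h, h₃⟩

theorem sub_rhs_mem_relSpan {a b : L} (h : S.red a b) :
    mon k [a, b] - S.rhs a b ∈ S.relSpan (S.weight a + S.weight b) :=
  Submodule.subset_span ⟨[], a, b, [], h, by simp, by simp⟩

theorem mul_relSpan_mul {d d' r s t : ℕ} {x y z : FreeAlgebra k L} (hx : x ∈ S.fil d r)
    (hy : y ∈ S.relSpan s) (hz : z ∈ S.fil d' t) : x * y * z ∈ S.relSpan (r + s + t) := by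
  have := Submodule.mul_mem_mul (Submodule.mul_mem_mul hx hy) hz
  rw [fil, fil, relSpan, Submodule.span_mul_span, Submodule.span_mul_span] at this
  refine Submodule.span_mono ?_ this
  rintro _ ⟨_, ⟨_, ⟨l, hl, rfl⟩, _, ⟨p, a, b, q, h, h', rfl⟩, rfl⟩, _, ⟨l', hl', rfl⟩, rfl⟩
  refine ⟨l ++ p, a, b, q ++ l', h, ?_, by simp only [mon_append, mul_assoc]⟩
  have h₁ := hl.2
  have h₂ := hl'.2
  simp at h' ⊢
  omega

theorem ofWords_congr {M : Type*} [AddCommGroup M] [Module k M] {g g' : List L → M} {d r : ℕ}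
    (h : ∀ l, S.wdeg l = d → S.wwt l ≤ r → g l = g' l) {x : FreeAlgebra k L}
    (hx : x ∈ S.fil d r) : ofWords (k := k) g x = ofWords g' x := by
  induction hx using Submodule.span_induction with
  | mem x hx =>
    obtain ⟨l, hl, rfl⟩ := hx
    simpa using h l hl.1 hl.2
  | zero => simp
  | add x y _ _ hx hy => simp [hx, hy]
  | smul c x _ hx => simp [hx]

/-- A word is irreducible if no rule applies to it. -/
def Irred (l : List L) : Prop := l.IsChain fun a b => ¬ S.red a b

/-- The first reducible pair in a word is `a b`, after the word `p`. -/
def Leftmost (l p : List L) (a b : L) (q : List L) : Prop :=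
  l = p ++ a :: b :: q ∧ S.red a b ∧ S.Irred (p ++ [a])

theorem exists_leftmost {l : List L} (h : ¬ S.Irred l) : ∃ p a b q, S.Leftmost l p a b q := by
  induction l with
  | nil => exact absurd List.IsChain.nil h
  | cons a l ih =>
    cases l with
    | nil => exact absurd (List.IsChain.singleton a) h
    | cons b l =>
      by_cases hab : S.red a b
      · exact ⟨[], a, b, l, rfl, hab, List.IsChain.singleton a⟩
      · have h' : ¬ S.Irred (b :: l) := fun h' => h (List.isChain_cons_cons.2 ⟨hab, h'⟩)
        obtain ⟨p, c, d, q, e, hr, hi⟩ := ih h'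
        refine ⟨a :: p, c, d, q, by rw [e]; rfl, hr, ?_⟩
        cases p with
        | nil =>
          obtain ⟨rfl, -⟩ := List.cons.inj e
          exact List.isChain_cons_cons.2 ⟨hab, hi⟩
        | cons x p =>
          obtain ⟨rfl, -⟩ := List.cons.inj e
          exact List.isChain_cons_cons.2 ⟨hab, hi⟩

/-- The prefix up to and including `a` is irreducible, so no reducible pair can end inside it. What
remains is the same pair, an overlap in one letter, or a disjoint pair to the right: the three cases
of the diamond lemma. -/
theorem Leftmost.cases {l p q p' q' : List L} {a b a' b' : L} (h : S.Leftmost l p a b q)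
    (e : l = p' ++ a' :: b' :: q') (hr : S.red a' b') :
    (p' = p ∧ a' = a ∧ b' = b ∧ q' = q) ∨
      (p' = p ++ [a] ∧ a' = b ∧ q = b' :: q') ∨
      ∃ c, p' = p ++ a :: b :: c ∧ q = c ++ a' :: b' :: q' := by
  obtain ⟨e', -, hi⟩ := h
  rw [e', List.append_eq_append_iff] at e
  rcases e with ⟨c, hc, hc'⟩ | ⟨c, hc, hc'⟩
  · match c with
    | [] =>
      simp at hc hc'
      exact Or.inl ⟨hc, hc'.1.symm, hc'.2.1.symm, hc'.2.2.symm⟩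
    | [x] =>
      simp at hc'
      obtain ⟨rfl, rfl, rfl⟩ := hc'
      exact Or.inr (Or.inl ⟨hc, rfl, rfl⟩)
    | x :: y :: c =>
      simp at hc'
      obtain ⟨rfl, rfl, rfl⟩ := hc'
      exact Or.inr (Or.inr ⟨c, hc, rfl⟩)
  · match c with
    | [] =>
      simp at hc hc'
      exact Or.inl ⟨hc.symm, hc'.1, hc'.2.1, hc'.2.2⟩
    | [x] =>
      simp at hc'
      obtain ⟨rfl, rfl, -⟩ := hc'
      subst hc
      exfalso
      exact ((List.isChain_append_cons_cons (R := fun a b => ¬ S.red a b) (l₁ := p') (b := a')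
            (c := b') (l₂ := [])).1
            (by simpa [Irred] using hi)).2.1 hr
    | x :: y :: c =>
      simp at hc'
      obtain ⟨rfl, rfl, -⟩ := hc'
      subst hc
      exfalso
      exact ((List.isChain_append_cons_cons (R := fun a b => ¬ S.red a b) (l₁ := p') (b := a')
            (c := b') (l₂ := c ++ [a])).1
            (by simpa [Irred] using hi)).2.1 hr

open Classical in
/-- The normal form of a word, obtained by rewriting the leftmost reducible pair. -/
noncomputable def nfWord : List L → FreeAlgebra k L :=
  (measure S.wwt).wf.fix fun l rec =>
    if h : ∃ t : List L × L × L × List L, S.Leftmost l t.1 t.2.1 t.2.2.1 t.2.2.2 then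
      ofWords (fun l' => if h' : S.wwt l' < S.wwt l then rec l' h' else 0)
        (mon k h.choose.1 * S.rhs h.choose.2.1 h.choose.2.2.1 * mon k h.choose.2.2.2)
    else mon k l

/-- The linear extension of the normal form. -/
noncomputable def nf : FreeAlgebra k L →ₗ[k] FreeAlgebra k L := ofWords S.nfWord

@[simp] theorem nf_mon (l : List L) : S.nf (mon k l) = S.nfWord l := ofWords_mon _ _

theorem nf_mon_of_irred {l : List L} (h : S.Irred l) : S.nf (mon k l) = mon k l := by
  rw [nf_mon, nfWord, WellFounded.fix_eq, dif_neg]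
  rintro ⟨⟨p, a, b, q⟩, rfl, hr, -⟩
  exact (List.isChain_append_cons_cons.1 h).2.1 hr

/-- The right hand sides are homogeneous of smaller weight. -/
def Decreasing : Prop :=
  ∀ a b, S.red a b → ∃ r < S.weight a + S.weight b, S.rhs a b ∈ S.fil (S.deg a + S.deg b) r

/-- The overlap ambiguities are resolvable relative to the weight. -/
def Resolvable : Prop :=
  ∀ a b c, S.red a b → S.red b c → ∃ r < S.weight a + S.weight b + S.weight c,
    S.rhs a b * mon k [c] - mon k [a] * S.rhs b c ∈ S.relSpan r

variable {S}

theorem nf_mon_of_leftmost (hS : S.Decreasing) {l p q : List L} {a b : L}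
    (h : S.Leftmost l p a b q) : S.nf (mon k l) = S.nf (mon k p * S.rhs a b * mon k q) := by
  have hex : ∃ t : List L × L × L × List L, S.Leftmost l t.1 t.2.1 t.2.2.1 t.2.2.2 :=
    ⟨(p, a, b, q), h⟩
  have hs := hex.choose_spec
  have heq : hex.choose = (p, a, b, q) := by
    suffices hex.choose.1 = p ∧ hex.choose.2.1 = a ∧ hex.choose.2.2.1 = b ∧
        hex.choose.2.2.2 = q by
      obtain ⟨h₁, h₂, h₃, h₄⟩ := this
      rw [← h₁, ← h₂, ← h₃, ← h₄]
    have i₁ := h.cases S hs.1 hs.2.1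
    have i₂ := hs.cases S h.1 h.2.1
    -- Either of two leftmost pairs is the other or lies strictly to its right; comparing prefix
    -- lengths in both directions leaves only equality.
    rcases i₁ with i₁ | ⟨i₁, -⟩ | ⟨c, i₁, -⟩
    · exact i₁
    all_goals
      exfalso
      have i₁ := congrArg List.length i₁
      rcases i₂ with ⟨i₂, -⟩ | ⟨i₂, -⟩ | ⟨c, i₂, -⟩
      all_goals
        have i₂ := congrArg List.length i₂
        simp at i₁ i₂
        try omega
  rw [nf_mon, nfWord, WellFounded.fix_eq, dif_pos hex, heq]
  obtain ⟨r, hr, hm⟩ := hS a b h.2.1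
  have hm' := S.mul_mem_fil (S.mul_mem_fil (S.mon_mem_fil (l := p) rfl le_rfl) hm)
    (S.mon_mem_fil (l := q) rfl le_rfl)
  refine S.ofWords_congr (fun l' _ hl' => ?_) hm'
  have : S.wwt l' < S.wwt l := by
    rw [h.1]
    simp
    omega
  rw [dif_pos this]
  rfl

/-- Induction on the weight bound. After the leftmost pair of `p' a' b' q'` is rewritten, what is
left is a combination of consequences of the rules of strictly smaller weight. -/
theorem nf_rel (hS : S.Decreasing) (hS' : S.Resolvable) (r : ℕ) :
    ∀ x ∈ S.relSpan r, S.nf x = 0 := by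
  induction r using Nat.strong_induction_on with
  | _ r ih =>
  intro x hx
  refine (Submodule.span_le (p := LinearMap.ker S.nf)).2 ?_ hx
  rintro _ ⟨p', a', b', q', hr', hw, rfl⟩
  rw [SetLike.mem_coe, LinearMap.mem_ker]
  obtain ⟨p, a, b, q, h⟩ := S.exists_leftmost (l := p' ++ a' :: b' :: q')
    (fun h => (List.isChain_append_cons_cons.1 h).2.1 hr')
  have hab := h.2.1
  have key := nf_mon_of_leftmost hS h
  obtain ⟨s, hs, hsm⟩ := hS a b hab
  obtain ⟨s', hs', hsm'⟩ := hS a' b' hr'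
  have split : mon k p' * (mon k [a', b'] - S.rhs a' b') * mon k q' =
      mon k (p' ++ a' :: b' :: q') - mon k p' * S.rhs a' b' * mon k q' := by
    rw [mul_sub, sub_mul, ← mon_append, ← mon_append]
    simp
  rw [split, map_sub, key, ← map_sub]
  rcases h.cases S rfl hr' with ⟨rfl, rfl, rfl, rfl⟩ | ⟨rfl, rfl, rfl⟩ | ⟨c, rfl, rfl⟩
  · simp
  -- Overlap: the difference of the two reductions is the ambiguity of `a`, `b`, `b'` placed in
  -- context, resolvable in smaller weight.
  · obtain ⟨t, ht, htm⟩ := hS' a a' b' hab hr'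
    have hm := S.mul_relSpan_mul (S.mon_mem_fil (l := p) rfl le_rfl) htm
      (S.mon_mem_fil (l := q') rfl le_rfl)
    simp at hw
    refine ih _ ?_ _ (by
      convert hm using 1
      rw [mon_append, mon_cons b' q']
      simp only [mul_sub, sub_mul, mul_assoc])
    omega
  · have hc : mon k c ∈ S.fil _ _ := S.mon_mem_fil (l := c) rfl le_rfl
    have hp : mon k p ∈ S.fil _ _ := S.mon_mem_fil (l := p) rfl le_rfl
    have hq : mon k q' ∈ S.fil _ _ := S.mon_mem_fil (l := q') rfl le_rfl
    -- Disjoint pairs: the difference of the two reductions is (right side)·(rule) minus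
    -- (rule)·(right side). Each summand has smaller weight because right sides are lighter than the
    -- pairs they replace.
    have m₁ := S.mul_relSpan_mul (S.mul_mem_fil (S.mul_mem_fil hp hsm) hc)
      (S.sub_rhs_mem_relSpan hr') hq
    have m₂ := S.mul_relSpan_mul hp (S.sub_rhs_mem_relSpan hab)
      (S.mul_mem_fil (S.mul_mem_fil hc hsm') hq)
    simp at hw
    have e₁ := ih _ (by omega) _ m₁
    have e₂ := ih _ (by omega) _ m₂
    have : mon k p * S.rhs a b * mon k (c ++ a' :: b' :: q') -
        mon k (p ++ a :: b :: c) * S.rhs a' b' * mon k q' =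
        mon k p * S.rhs a b * mon k c * (mon k [a', b'] - S.rhs a' b') * mon k q' -
        mon k p * (mon k [a, b] - S.rhs a b) * (mon k c * S.rhs a' b' * mon k q') := by
      have h₁ : mon k (c ++ a' :: b' :: q') = mon k c * mon k [a', b'] * mon k q' := by
        rw [← mon_append, ← mon_append]; simp
      have h₂ : mon k (p ++ a :: b :: c) = mon k p * mon k [a, b] * mon k c := by
        rw [← mon_append, ← mon_append]; simp
      rw [h₁, h₂]
      simp only [mul_sub, sub_mul, mul_assoc]
      abel
    rw [this, map_sub, e₁, e₂, sub_zero]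

theorem nf_mul_sub_mul (hS : S.Decreasing) (hS' : S.Resolvable) {a b : L} (h : S.red a b)
    (x y : FreeAlgebra k L) : S.nf (x * (mon k [a, b] - S.rhs a b) * y) = 0 := by
  have hx : x ∈ Submodule.span k (Set.range (mon k)) := by rw [span_range_mon]; trivial
  have hy : y ∈ Submodule.span k (Set.range (mon k)) := by rw [span_range_mon]; trivial
  induction hx using Submodule.span_induction with
  | mem x hx =>
    obtain ⟨p, rfl⟩ := hx
    induction hy using Submodule.span_induction with
    | mem y hy =>
      obtain ⟨q, rfl⟩ := hy
      exact nf_rel hS hS' _ _ (Submodule.subset_span ⟨p, a, b, q, h, le_rfl, rfl⟩)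
    | zero => simp
    | add y y' _ _ hy hy' => rw [mul_add, map_add, hy, hy', add_zero]
    | smul c y _ hy => rw [mul_smul_comm, map_smul, hy, smul_zero]
  | zero => simp
  | add y y' _ _ hy hy' => rw [add_mul, add_mul, map_add, hy, hy', add_zero]
  | smul c y _ hy => rw [smul_mul_assoc, smul_mul_assoc, map_smul, hy, smul_zero]

/-- In an algebra in which the rules hold, every word is a combination of irreducible words of
the same degree. -/
theorem map_mon_mem_span_irred (hS : S.Decreasing) {A : Type*} [Ring A] [Algebra k A]
    (φ : FreeAlgebra k L →ₐ[k] A) (hφ : ∀ a b, S.red a b → φ (mon k [a, b]) = φ (S.rhs a b))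
    (l : List L) :
    φ (mon k l) ∈
      Submodule.span k ((fun l => φ (mon k l)) '' {l' | S.Irred l' ∧ S.wdeg l' = S.wdeg l}) := by
  induction h : S.wwt l using Nat.strong_induction_on generalizing l with
  | _ r ih =>
  subst h
  by_cases hl : S.Irred l
  · exact Submodule.subset_span ⟨l, ⟨hl, rfl⟩, rfl⟩
  · obtain ⟨p, a, b, q, rfl, hr, -⟩ := S.exists_leftmost hl
    obtain ⟨s, hs, hsm⟩ := hS a b hr
    have hm := S.mul_mem_fil (S.mul_mem_fil (S.mon_mem_fil (l := p) rfl le_rfl) hsm)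
      (S.mon_mem_fil (l := q) rfl le_rfl)
    have e : φ (mon k (p ++ a :: b :: q)) = φ (mon k p * S.rhs a b * mon k q) := by
      have : mon k (p ++ a :: b :: q) = mon k p * mon k [a, b] * mon k q := by
        rw [← mon_append, ← mon_append]; simp
      rw [this, map_mul, map_mul, hφ a b hr, ← map_mul, ← map_mul]
    rw [e]
    suffices h : S.fil _ _ ≤ Submodule.comap φ.toLinearMap (Submodule.span k
        ((fun l => φ (mon k l)) '' {l' | S.Irred l' ∧ S.wdeg l' = S.wdeg (p ++ a :: b :: q)})) from
      h hm
    refine Submodule.span_le.2 ?_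
    rintro _ ⟨l', ⟨hd, hw⟩, rfl⟩
    have := ih (S.wwt l') (by simp; omega) l' rfl
    have hd' : S.wdeg l' = S.wdeg (p ++ a :: b :: q) := by rw [hd]; simp; omega
    rwa [hd'] at this

end QuadraticRewriting

/-! ### Numerical estimates for the weights. -/

/-- The weight of a letter `(v, i)` for which `v` has rank `s`. -/
def letterWeight (s i : ℕ) : ℕ := if i = 0 then 0 else s * (s + 1) - (s - i) * (s - i + 1) + 1

@[simp] theorem letterWeight_zero (s : ℕ) : letterWeight s 0 = 0 := rfl

/-- Apart from the final `+ 1`, the weight of $(v,i)$ is the sum of the $i$ largest numbers $2r$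
with $r\le\rho(v)$. Together with `letterWeight_self_add` this shows that for $\rho(v)=\rho(u)+a$
the letter $(v,a+b)$ weighs exactly one less than the word $(v,a)(u,b)$; the `+ 1` per letter
provides that drop. -/
theorem letterWeight_add (t a b : ℕ) (ha : 1 ≤ a) :
    letterWeight (t + b + a) (a + b) = letterWeight (t + b + a) a + b * (2 * t + b + 1) := by
  have h₁ : t + b + a - (a + b) = t := by omega
  have h₂ : t + b + a - a = t + b := by omega
  rw [letterWeight, letterWeight, if_neg (by omega), if_neg (by omega), h₁, h₂]
  have : (t + b) * (t + b + 1) ≤ (t + b + a) * (t + b + a + 1) := Nat.mul_le_mul (by omega) (by omega)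
  have : t * (t + 1) ≤ (t + b) * (t + b + 1) := Nat.mul_le_mul (by omega) (by omega)
  have : (t + b) * (t + b + 1) = t * (t + 1) + b * (2 * t + b + 1) := by ring
  omega

theorem letterWeight_self_add (t b : ℕ) (hb : 1 ≤ b) :
    letterWeight (t + b) b = b * (2 * t + b + 1) + 1 := by
  have h₁ : t + b - b = t := by omega
  rw [letterWeight, if_neg (by omega), h₁]
  have : (t + b) * (t + b + 1) = t * (t + 1) + b * (2 * t + b + 1) := by ring
  omega

theorem letterWeight_pos {s i : ℕ} (hi : 1 ≤ i) : 1 ≤ letterWeight s i := by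
  rw [letterWeight, if_neg (by omega)]
  omega

/-- Moving $b$ units of degree from a letter at rank $S$ down to rank $s$, where a unit costs at
most $2s+1$, saves weight at least $b$: the units removed are worth at least $2s+2$ each. -/
theorem letterWeight_add_le (S s a b : ℕ) (h : a + b + s ≤ S) :
    letterWeight S a + b * (2 * s + 1) + b ≤ letterWeight S (a + b) := by
  obtain ⟨t, rfl⟩ := Nat.exists_eq_add_of_le h
  rcases Nat.eq_zero_or_pos a with rfl | ha
  · rcases Nat.eq_zero_or_pos b with rfl | hb
    · simp
    · have e := letterWeight_self_add (s + t) b hb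
      have := Nat.le_mul_self b
      rw [show 0 + b + s + t = s + t + b by ring, zero_add, e, letterWeight_zero]
      nlinarith [Nat.zero_le (b * t)]
  · have e := letterWeight_add (s + t) a b ha
    have := Nat.le_mul_self b
    rw [show a + b + s + t = s + t + b + a by ring, e]
    nlinarith [Nat.zero_le (b * t)]

theorem letterWeight_add_le_of_pos (s a b : ℕ) (ha : 1 ≤ a) :
    letterWeight s (a + b) ≤ letterWeight s a + b * (2 * s + 1) := by
  induction b with
  | zero => simp
  | succ b ih =>
    have : letterWeight s (a + (b + 1)) ≤ letterWeight s (a + b) + (2 * s + 1) := by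
      rw [letterWeight, letterWeight, if_neg (by omega), if_neg (by omega)]
      rcases Nat.lt_or_ge (a + b) s with h | h
      · obtain ⟨t, rfl⟩ := Nat.exists_eq_add_of_lt h
        rw [show a + b + t + 1 - (a + (b + 1)) = t by omega,
          show a + b + t + 1 - (a + b) = t + 1 by omega]
        have : (t + 1) * (t + 1 + 1) = t * (t + 1) + 2 * (t + 1) := by ring
        omega
      · rw [show s - (a + (b + 1)) = 0 by omega, show s - (a + b) = 0 by omega]
        omega
    rw [add_mul]
    omega

theorem letterWeight_le (s i : ℕ) : letterWeight s i ≤ i * (2 * s + 1) := by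
  rcases Nat.eq_zero_or_pos i with rfl | hi
  · simp
  · obtain ⟨b, rfl⟩ := Nat.exists_eq_add_of_le hi
    refine (letterWeight_add_le_of_pos s 1 b le_rfl).trans ?_
    have : letterWeight s 1 ≤ 2 * s + 1 := by
      rw [letterWeight, if_neg one_ne_zero]
      cases s with
      | zero => simp
      | succ s =>
        have : (s + 1) * (s + 1 + 1) = s * (s + 1) + 2 * (s + 1) := by ring
        rw [Nat.add_sub_cancel]
        omega
    rw [Nat.succ_eq_add_one, zero_add, add_mul, one_mul]
    omega

/-! ### The division rules and their termination. -/

/-- The letters `(v, i)` with `1 ≤ i ≤ ρ v`, which stand for the elements `e(π, i)` for the paths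
`π` from `v` down to the minimal vertex. -/
abbrev RankLetter {V : Type*} (ρ : V → ℕ) : Type _ := {p : V × ℕ // 1 ≤ p.2 ∧ p.2 ≤ ρ p.1}

namespace RankLetter

open PowerSeries QuadraticRewriting
open Finset.HasAntidiagonal (antidiagonal mem_antidiagonal)

variable (K : Type*) {V : Type*} [Field K] (ρ : V → ℕ)

/-- The letter `(v, i)` as an element of the free algebra, with `(v, 0) = 1` and `(v, i) = 0` for
`i > ρ v`. -/
noncomputable def elem (v : V) (i : ℕ) : FreeAlgebra K (RankLetter ρ) :=
  if h : 1 ≤ i ∧ i ≤ ρ v then mon K [⟨(v, i), h⟩] else if i = 0 then 1 else 0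

@[simp] theorem elem_zero (v : V) : elem K ρ v 0 = 1 := by simp [elem]

theorem elem_of_lt {v : V} {i : ℕ} (h : ρ v < i) : elem K ρ v i = 0 := by
  rw [elem, dif_neg (by omega), if_neg (by omega)]

theorem elem_letter (a : RankLetter ρ) : elem K ρ a.1.1 a.1.2 = mon K [a] := by
  rw [elem, dif_pos a.2]

/-- The generating function of the letters at `v`. -/
noncomputable def series (v : V) : (FreeAlgebra K (RankLetter ρ))⟦X⟧ := PowerSeries.mk (elem K ρ v)

/-- The inverse of the generating function of the letters at `v`. -/
noncomputable def seriesInv (v : V) : (FreeAlgebra K (RankLetter ρ))⟦X⟧ :=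
  invOfUnit (series K ρ v) 1

theorem constantCoeff_series (v : V) : constantCoeff (series K ρ v) = 1 := by
  simp [series]

theorem series_mul_seriesInv (v : V) : series K ρ v * seriesInv K ρ v = 1 :=
  mul_invOfUnit _ _ (by simp [constantCoeff_series])

theorem seriesInv_mul_series (v : V) : seriesInv K ρ v * series K ρ v = 1 :=
  invOfUnit_mul _ _ (by simp [constantCoeff_series])

/-- The part of degree at most `ρ v - ρ u` of the quotient of the generating functions. -/
noncomputable def lowQuot (v u : V) : (FreeAlgebra K (RankLetter ρ))⟦X⟧ :=
  PowerSeries.mk fun n => if n ≤ ρ v - ρ u then coeff n (series K ρ v * seriesInv K ρ u) else 0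

/-- The remainder of the division of the generating function at `v` by that at `u`. -/
noncomputable def remainder (v u : V) : (FreeAlgebra K (RankLetter ρ))⟦X⟧ :=
  series K ρ v - lowQuot K ρ v u * series K ρ u

theorem coeff_lowQuot_of_lt {v u : V} {n : ℕ} (h : ρ v - ρ u < n) :
    coeff n (lowQuot K ρ v u) = 0 := by
  rw [lowQuot, coeff_mk, if_neg (by omega)]

theorem coeff_remainder_of_le {v u : V} {n : ℕ} (h : n ≤ ρ v - ρ u) :
    coeff n (remainder K ρ v u) = 0 := by
  have : remainder K ρ v u =
      (series K ρ v * seriesInv K ρ u - lowQuot K ρ v u) * series K ρ u := by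
    rw [sub_mul, mul_assoc, seriesInv_mul_series, mul_one, remainder]
  rw [this, coeff_mul]
  refine Finset.sum_eq_zero fun p hp => ?_
  have := mem_antidiagonal.1 hp
  rw [map_sub, lowQuot, coeff_mk, if_pos (by omega), sub_self, zero_mul]

theorem coeff_remainder_of_lt {v u : V} (h : ρ u ≤ ρ v) {n : ℕ} (hn : ρ v < n) :
    coeff n (remainder K ρ v u) = 0 := by
  rw [remainder, map_sub, series, coeff_mk, elem_of_lt K ρ hn, zero_sub, neg_eq_zero, coeff_mul]
  refine Finset.sum_eq_zero fun p hp => ?_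
  have := mem_antidiagonal.1 hp
  rcases Nat.lt_or_ge (ρ v - ρ u) p.1 with h' | h'
  · rw [coeff_lowQuot_of_lt K ρ h', zero_mul]
  · rw [series, coeff_mk, elem_of_lt K ρ (by omega), mul_zero]

/-- The rewriting system in which `(v, i)(u, j)` is reducible if `v > u` and
`i = ρ v - ρ u`: the rule says that the remainder of the division of the generating function at
`v` by that at `u` vanishes. -/
noncomputable def system [Preorder V] : QuadraticRewriting K (RankLetter ρ) where
  red a b := b.1.1 < a.1.1 ∧ ρ a.1.1 = ρ b.1.1 + a.1.2
  rhs a b := mon K [a, b] + coeff (a.1.2 + b.1.2) (remainder K ρ a.1.1 b.1.1)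
  deg a := a.1.2
  weight a := letterWeight (ρ a.1.1) a.1.2

variable [Preorder V]

theorem one_mem_fil : (1 : FreeAlgebra K (RankLetter ρ)) ∈ (system K ρ).fil 0 0 :=
  (system K ρ).mon_mem_fil (l := []) rfl le_rfl

theorem elem_mem_fil (v : V) (i : ℕ) :
    elem K ρ v i ∈ (system K ρ).fil i (letterWeight (ρ v) i) := by
  rw [elem]
  split_ifs with h h'
  · exact (system K ρ).mon_mem_fil (by simp [system]) (by simp [system])
  · subst h'
    exact one_mem_fil K ρ
  · exact zero_mem _

/-- The recursion for the inverse expresses a coefficient through letters at `v` and earlier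
coefficients; the cost $2\rho(v)+1$ per unit of degree is additive. -/
theorem coeff_seriesInv_mem_fil (v : V) (n : ℕ) :
    coeff n (seriesInv K ρ v) ∈ (system K ρ).fil n (n * (2 * ρ v + 1)) := by
  induction n using Nat.strong_induction_on with
  | _ n ih =>
  rcases Nat.eq_zero_or_pos n with rfl | hn
  · have : coeff 0 (seriesInv K ρ v) = 1 := by
      simp [seriesInv]
    rw [this, zero_mul]
    exact one_mem_fil K ρ
  · have h := congrArg (coeff n) (series_mul_seriesInv K ρ v)
    rw [coeff_mul, coeff_one, if_neg (by omega),
      ← Finset.add_sum_erase _ _ (mem_antidiagonal (a := (0, n)).2 (zero_add n))] at h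
    simp only [series, coeff_mk, elem_zero, one_mul] at h
    rw [eq_neg_of_add_eq_zero_left h]
    refine neg_mem (Submodule.sum_mem _ fun p hp => ?_)
    obtain ⟨hp, hp'⟩ := Finset.mem_erase.1 hp
    have hp' := mem_antidiagonal.1 hp'
    have h0 : p.1 ≠ 0 := fun h0 => hp (Prod.ext h0 (by simp; omega))
    have := (system K ρ).mul_mem_fil (elem_mem_fil K ρ v p.1) (ih p.2 (by omega))
    rw [hp'] at this
    refine (system K ρ).fil_mono ?_ this
    calc _ ≤ p.1 * (2 * ρ v + 1) + p.2 * (2 * ρ v + 1) := by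
          gcongr
          exact letterWeight_le _ _
      _ = _ := by rw [← add_mul, hp']

/-- The letter $(v,i)$ is the leading term of the quotient. Every other term involves a positive
degree of the inverse series at `u`, and lowering degree to that rank loses weight. -/
theorem coeff_lowQuot_sub_mem_fil {v u : V} {i : ℕ} (hi : 1 ≤ i) (h : i + ρ u ≤ ρ v) :
    coeff i (lowQuot K ρ v u) - elem K ρ v i ∈
      (system K ρ).fil i (letterWeight (ρ v) i - 1) := by
  rw [lowQuot, coeff_mk, if_pos (by omega), coeff_mul,
    ← Finset.add_sum_erase _ _ (mem_antidiagonal (a := (i, 0)).2 (add_zero i))]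
  have : coeff 0 (seriesInv K ρ u) = 1 := by simp [seriesInv]
  simp only [this, mul_one, series, coeff_mk, add_sub_cancel_left]
  refine Submodule.sum_mem _ fun p hp => ?_
  obtain ⟨hp, hp'⟩ := Finset.mem_erase.1 hp
  have hp' := mem_antidiagonal.1 hp'
  have h0 : p.2 ≠ 0 := fun h0 => hp (Prod.ext (by simp; omega) h0)
  have := (system K ρ).mul_mem_fil (elem_mem_fil K ρ v p.1) (coeff_seriesInv_mem_fil K ρ u p.2)
  rw [hp'] at this
  refine (system K ρ).fil_mono ?_ this
  have := letterWeight_add_le (ρ v) (ρ u) p.1 p.2 (by omega)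
  rw [hp'] at this
  omega

theorem coeff_lowQuot_mem_fil {v u : V} {i : ℕ} (h : i + ρ u ≤ ρ v) :
    coeff i (lowQuot K ρ v u) ∈ (system K ρ).fil i (letterWeight (ρ v) i) := by
  rcases Nat.eq_zero_or_pos i with rfl | hi
  · have : coeff 0 (lowQuot K ρ v u) = 1 := by
      simp [lowQuot, series, seriesInv]
    rw [this]
    exact one_mem_fil K ρ
  · have := add_mem ((system K ρ).fil_mono (Nat.sub_le _ 1)
      (coeff_lowQuot_sub_mem_fil K ρ hi h)) (elem_mem_fil K ρ v i)
    rwa [sub_add_cancel] at this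

/-- In degrees above $\rho(v)-\rho(u)$ and at most $\rho(v)$ the coefficient is minus a rule; in all
other degrees it is zero. The bound is the weight of the left side of that rule. -/
theorem coeff_remainder_mem_relSpan {v u : V} (h : u < v) (hρ : ρ u < ρ v) (n : ℕ) :
    coeff n (remainder K ρ v u) ∈ (system K ρ).relSpan
      (letterWeight (ρ v) (ρ v - ρ u) + letterWeight (ρ u) (n - (ρ v - ρ u))) := by
  rcases Nat.lt_or_ge (ρ v - ρ u) n with h₁ | h₁
  · rcases Nat.lt_or_ge (ρ v) n with h₂ | h₂
    · rw [coeff_remainder_of_lt K ρ hρ.le h₂]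
      exact zero_mem _
    · let a : RankLetter ρ := ⟨(v, ρ v - ρ u), by dsimp; omega⟩
      let b : RankLetter ρ := ⟨(u, n - (ρ v - ρ u)), by dsimp; omega⟩
      have := (system K ρ).sub_rhs_mem_relSpan (a := a) (b := b) ⟨h, by dsimp [a, b]; omega⟩
      have e : mon K [a, b] - (system K ρ).rhs a b = - coeff n (remainder K ρ v u) := by
        have : a.1.2 + b.1.2 = n := by dsimp [a, b]; omega
        simp only [system, this]
        abel
      rw [e, neg_mem_iff] at this
      exact this
  · rw [coeff_remainder_of_le K ρ h₁]
    exact zero_mem _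

theorem system_decreasing : (system K ρ).Decreasing := by
  rintro a b ⟨h, hρ⟩
  have ha := a.2
  have hb := b.2
  have hw := letterWeight_pos (s := ρ a.1.1) ha.1
  have hw' := letterWeight_pos (s := ρ b.1.1) hb.1
  refine ⟨letterWeight (ρ a.1.1) a.1.2 + letterWeight (ρ b.1.1) b.1.2 - 1, by
    simp only [system]; omega, ?_⟩
  have hd : ρ a.1.1 - ρ b.1.1 = a.1.2 := by omega
  -- The word $(v,i)(u,j)$ cancels the leading part of the $(i,j)$ term of the product; what is left
  -- is the letter $(v,i+j)$ and terms of lower weight.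
  have e : (system K ρ).rhs a b = elem K ρ a.1.1 (a.1.2 + b.1.2) -
      ((coeff a.1.2 (lowQuot K ρ a.1.1 b.1.1) - elem K ρ a.1.1 a.1.2) * elem K ρ b.1.1 b.1.2 +
        ∑ p ∈ (antidiagonal (a.1.2 + b.1.2)).erase (a.1.2, b.1.2),
          coeff p.1 (lowQuot K ρ a.1.1 b.1.1) * elem K ρ b.1.1 p.2) := by
    have hm : (a.1.2, b.1.2) ∈ antidiagonal (a.1.2 + b.1.2) :=
      mem_antidiagonal.2 rfl
    simp only [system, remainder, map_sub, coeff_mul, ← Finset.add_sum_erase _ _ hm]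
    simp only [series, coeff_mk]
    rw [sub_mul, elem_letter, elem_letter, mon_cons]
    abel
  rw [e]
  change _ ∈ (system K ρ).fil (a.1.2 + b.1.2) _
  refine sub_mem ?_ (add_mem ?_ (Submodule.sum_mem _ fun p hp => ?_))
  · refine (system K ρ).fil_mono ?_ (elem_mem_fil K ρ _ _)
    have e₁ := letterWeight_add (ρ b.1.1 - b.1.2) a.1.2 b.1.2 ha.1
    have e₂ := letterWeight_self_add (ρ b.1.1 - b.1.2) b.1.2 hb.1
    rw [Nat.sub_add_cancel hb.2] at e₁ e₂
    rw [hρ, e₁, e₂]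
    omega
  · have := (system K ρ).mul_mem_fil (coeff_lowQuot_sub_mem_fil K ρ (v := a.1.1) (u := b.1.1) ha.1
      (by omega)) (elem_mem_fil K ρ b.1.1 b.1.2)
    refine (system K ρ).fil_mono ?_ this
    omega
  · obtain ⟨hp, hp'⟩ := Finset.mem_erase.1 hp
    have hp' := mem_antidiagonal.1 hp'
    rcases Nat.lt_or_ge a.1.2 p.1 with h₁ | h₁
    · rw [coeff_lowQuot_of_lt K ρ (by omega), zero_mul]
      exact zero_mem _
    · have hne : p.1 ≠ a.1.2 := fun h0 => hp (Prod.ext h0 (by simp; omega))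
      have := (system K ρ).mul_mem_fil (coeff_lowQuot_mem_fil K ρ (v := a.1.1) (u := b.1.1)
        (i := p.1) (by omega)) (elem_mem_fil K ρ b.1.1 p.2)
      rw [hp'] at this
      -- Here $p_1<i$: the loss at `v` strictly exceeds the gain from $(u,j)$ to $(u,p_2)$.
      refine (system K ρ).fil_mono ?_ this
      have e₁ := letterWeight_add_le (ρ a.1.1) (ρ b.1.1) p.1 (a.1.2 - p.1) (by omega)
      have e₂ := letterWeight_add_le_of_pos (ρ b.1.1) b.1.2 (a.1.2 - p.1) hb.1
      rw [show p.1 + (a.1.2 - p.1) = a.1.2 by omega] at e₁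
      rw [show b.1.2 + (a.1.2 - p.1) = p.2 by omega] at e₂
      omega

end RankLetter

/-! ### Resolution of the overlaps. -/

namespace RankLetter

open PowerSeries QuadraticRewriting
open Finset.HasAntidiagonal (antidiagonal mem_antidiagonal)

variable (K : Type*) {V : Type*} [Field K] (ρ : V → ℕ)

theorem lowQuot_mul_remainder_add (v u x : V) :
    lowQuot K ρ v u * remainder K ρ u x + remainder K ρ v u +
      (lowQuot K ρ v u * lowQuot K ρ u x - lowQuot K ρ v x) * series K ρ x =
    remainder K ρ v x := by
  simp only [remainder, mul_sub, sub_mul, mul_assoc]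
  abel

/-- The identity `lowQuot_mul_remainder_add` is divided by the series at `x`. In these degrees the
remainder of `v` by `x` contributes nothing, so the failure of quotients to multiply is itself a
combination of remainders. -/
theorem coeff_lowQuot_mul_lowQuot_sub {v u x : V} {n : ℕ} (hn : n ≤ ρ v - ρ x) :
    coeff n (lowQuot K ρ v u * lowQuot K ρ u x - lowQuot K ρ v x) =
      - coeff n ((lowQuot K ρ v u * remainder K ρ u x + remainder K ρ v u) *
        seriesInv K ρ x) := by
  have e : lowQuot K ρ v u * lowQuot K ρ u x - lowQuot K ρ v x =
      remainder K ρ v x * seriesInv K ρ x -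
        (lowQuot K ρ v u * remainder K ρ u x + remainder K ρ v u) * seriesInv K ρ x := by
    rw [← lowQuot_mul_remainder_add K ρ v u x, ← sub_mul, add_sub_cancel_left, mul_assoc,
      series_mul_seriesInv, mul_one]
  rw [e, map_sub, coeff_mul, Finset.sum_eq_zero, zero_sub]
  intro p hp
  have := mem_antidiagonal.1 hp
  rw [coeff_remainder_of_le K ρ (by omega), zero_mul]

theorem coeff_lowQuot_mul_lowQuot_sub_of_lt {v u x : V} (h : ρ x ≤ ρ u) (h' : ρ u ≤ ρ v) {n : ℕ}
    (hn : ρ v - ρ x < n) :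
    coeff n (lowQuot K ρ v u * lowQuot K ρ u x - lowQuot K ρ v x) = 0 := by
  rw [map_sub, coeff_lowQuot_of_lt K ρ hn, sub_zero, coeff_mul]
  refine Finset.sum_eq_zero fun p hp => ?_
  have := mem_antidiagonal.1 hp
  rcases Nat.lt_or_ge (ρ v - ρ u) p.1 with h₁ | h₁
  · rw [coeff_lowQuot_of_lt K ρ h₁, zero_mul]
  · rw [coeff_lowQuot_of_lt K ρ (v := u) (by omega), mul_zero]

variable [Preorder V]

theorem fil_mul_relSpan {d r s : ℕ} {x y : FreeAlgebra K (RankLetter ρ)}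
    (hx : x ∈ (system K ρ).fil d r) (hy : y ∈ (system K ρ).relSpan s) :
    x * y ∈ (system K ρ).relSpan (r + s) := by
  simpa using (system K ρ).mul_relSpan_mul hx hy (one_mem_fil K ρ)

theorem relSpan_mul_fil {d r s : ℕ} {x y : FreeAlgebra K (RankLetter ρ)}
    (hx : x ∈ (system K ρ).relSpan s) (hy : y ∈ (system K ρ).fil d r) :
    x * y ∈ (system K ρ).relSpan (s + r) := by
  simpa using (system K ρ).mul_relSpan_mul (one_mem_fil K ρ) hx hy

section overlap

variable {v u x : V} {i j m : ℕ} (hvu : u < v) (hux : x < u) (hv : ρ v = ρ u + i)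
  (hu : ρ u = ρ x + j) (hi : 1 ≤ i) (hj : 1 ≤ j) (hm : 1 ≤ m)

include hm in
theorem coeff_seriesInv_mul_elem_mem_fil {p q r : ℕ} (h : p + q + r = i + j + m)
    (hpq : p + q ≤ i + j) :
    coeff q (seriesInv K ρ x) * elem K ρ x r ∈
      (system K ρ).fil (q + r) (letterWeight (ρ x) m + (i + j - p) * (2 * ρ x + 1)) := by
  refine (system K ρ).fil_mono ?_ ((system K ρ).mul_mem_fil
    (coeff_seriesInv_mem_fil K ρ x q) (elem_mem_fil K ρ x r))
  have := letterWeight_add_le_of_pos (ρ x) m (r - m) hm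
  rw [show m + (r - m) = r by omega] at this
  rw [show i + j - p = q + (r - m) by omega, add_mul]
  omega

include hvu hv hu hi hm in
theorem coeff_remainder_mul_mem_relSpan {p q r : ℕ} (h : p + q + r = i + j + m)
    (hpq : p + q ≤ i + j) (hp : p < i + j) :
    coeff p (remainder K ρ v u) * (coeff q (seriesInv K ρ x) * elem K ρ x r) ∈
      (system K ρ).relSpan (letterWeight (ρ v) i + letterWeight (ρ u) j +
        letterWeight (ρ x) m - 1) := by
  rcases Nat.lt_or_ge i p with hip | hip
  · refine (system K ρ).relSpan_mono ?_ (relSpan_mul_fil K ρ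
      (coeff_remainder_mem_relSpan K ρ hvu (by omega) p)
      (coeff_seriesInv_mul_elem_mem_fil K ρ hm h hpq))
    rw [show ρ v - ρ u = i by omega]
    have := letterWeight_add_le (ρ u) (ρ x) (p - i) (i + j - p) (by omega)
    rw [show p - i + (i + j - p) = j by omega] at this
    omega
  · rw [coeff_remainder_of_le K ρ (by omega), zero_mul]
    exact zero_mem _

include hux hv hu hi hj hm in
theorem coeff_lowQuot_mul_remainder_mul_mem_relSpan {p q r : ℕ} (h : p + q + r = i + j + m)
    (hpq : p + q ≤ i + j) :
    coeff p (lowQuot K ρ v u * remainder K ρ u x) *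
        (coeff q (seriesInv K ρ x) * elem K ρ x r) ∈
      (system K ρ).relSpan (letterWeight (ρ v) i + letterWeight (ρ u) j +
        letterWeight (ρ x) m - 1) := by
  rw [coeff_mul, Finset.sum_mul]
  refine Submodule.sum_mem _ fun y hy => ?_
  have hy := mem_antidiagonal.1 hy
  rcases Nat.lt_or_ge i y.1 with h₁ | h₁
  · rw [coeff_lowQuot_of_lt K ρ (by omega), zero_mul, zero_mul]
    exact zero_mem _
  rcases Nat.lt_or_ge j y.2 with h₂ | h₂
  · refine (system K ρ).relSpan_mono ?_ ((system K ρ).mul_relSpan_mul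
      (coeff_lowQuot_mem_fil K ρ (by omega))
      (coeff_remainder_mem_relSpan K ρ hux (by omega) y.2)
      (coeff_seriesInv_mul_elem_mem_fil K ρ hm h hpq))
    rw [show ρ u - ρ x = j by omega]
    have e₁ := letterWeight_add_le (ρ v) (ρ x) y.1 (i - y.1) (by omega)
    rw [show y.1 + (i - y.1) = i by omega,
      show i - y.1 = (y.2 - j) + (i + j - p) by omega, add_mul] at e₁
    have e₂ := letterWeight_le (ρ x) (y.2 - j)
    omega
  · rw [coeff_remainder_of_le K ρ (v := u) (by omega), mul_zero, zero_mul]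
    exact zero_mem _

include hux hv hu hi hj hm in
theorem coeff_lowQuot_mul_remainder_sub_mem_relSpan :
    coeff (i + j + m) (lowQuot K ρ v u * remainder K ρ u x) -
        elem K ρ v i * coeff (j + m) (remainder K ρ u x) ∈
      (system K ρ).relSpan (letterWeight (ρ v) i + letterWeight (ρ u) j +
        letterWeight (ρ x) m - 1) := by
  have hw := letterWeight_pos (s := ρ v) hi
  have hm' : (i, j + m) ∈ antidiagonal (i + j + m) := mem_antidiagonal.2 (by simp; omega)
  rw [coeff_mul, ← Finset.add_sum_erase _ _ hm', add_sub_right_comm, ← sub_mul]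
  refine add_mem ?_ (Submodule.sum_mem _ fun y hy => ?_)
  · refine (system K ρ).relSpan_mono ?_ (fil_mul_relSpan K ρ
      (coeff_lowQuot_sub_mem_fil K ρ hi (by omega))
      (coeff_remainder_mem_relSpan K ρ hux (by omega) _))
    rw [show ρ u - ρ x = j by omega, Nat.add_sub_cancel_left]
    dsimp only
    omega
  · obtain ⟨hy, hy'⟩ := Finset.mem_erase.1 hy
    have hy' := mem_antidiagonal.1 hy'
    have hne : y.1 ≠ i := fun h0 => hy (Prod.ext h0 (by simp; omega))
    rcases Nat.lt_or_ge i y.1 with h₁ | h₁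
    · rw [coeff_lowQuot_of_lt K ρ (by omega), zero_mul]
      exact zero_mem _
    · refine (system K ρ).relSpan_mono ?_ (fil_mul_relSpan K ρ
        (coeff_lowQuot_mem_fil K ρ (by omega))
        (coeff_remainder_mem_relSpan K ρ hux (by omega) _))
      rw [show ρ u - ρ x = j by omega]
      have e₁ := letterWeight_add_le (ρ v) (ρ x) y.1 (i - y.1) (by omega)
      have e₂ := letterWeight_add_le_of_pos (ρ x) m (i - y.1) hm
      rw [show y.1 + (i - y.1) = i by omega] at e₁
      rw [show m + (i - y.1) = y.2 - j by omega] at e₂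
      omega

include hvu hux hv hu hi hj hm in
-- Expanding the defect of the quotients into remainders, only $(\text{remainder of } v \text{ by }
-- u)_{i+j}\,(x,m)$ may have the full weight of the overlap. It occurs with sign $-1$ and is
-- cancelled by the second summand.
theorem coeff_seriesInv_mul_elem_sub_mem_relSpan :
    coeff (i + j + m) ((lowQuot K ρ v u * lowQuot K ρ u x - lowQuot K ρ v x) * series K ρ x) +
        coeff (i + j) (remainder K ρ v u) * elem K ρ x m ∈
      (system K ρ).relSpan (letterWeight (ρ v) i + letterWeight (ρ u) j +
        letterWeight (ρ x) m - 1) := by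
  have hm' : (i + j, m) ∈ antidiagonal (i + j + m) := mem_antidiagonal.2 rfl
  have key : ∀ y ∈ antidiagonal (i + j + m), ∀ z ∈ antidiagonal y.1, y.1 ≤ i + j →
      z.1 < i + j →
      coeff z.1 (lowQuot K ρ v u * remainder K ρ u x + remainder K ρ v u) *
        coeff z.2 (seriesInv K ρ x) * elem K ρ x y.2 ∈
      (system K ρ).relSpan (letterWeight (ρ v) i + letterWeight (ρ u) j +
        letterWeight (ρ x) m - 1) := by
    intro y hy z hz hyij hzij
    have hy := mem_antidiagonal.1 hy
    have hz := mem_antidiagonal.1 hz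
    rw [map_add, mul_assoc, add_mul]
    exact add_mem
      (coeff_lowQuot_mul_remainder_mul_mem_relSpan K ρ hux hv hu hi hj hm (by omega) (by omega))
      (coeff_remainder_mul_mem_relSpan K ρ hvu hv hu hi hm (by omega) (by omega) hzij)
  have e' : ∀ a b c : FreeAlgebra K (RankLetter ρ), a + b + c = a + c + b := add_right_comm
  rw [coeff_mul, ← Finset.add_sum_erase _ _ hm', e']
  refine add_mem ?_ (Submodule.sum_mem _ fun y hy => ?_)
  · have hz' : (i + j, 0) ∈ antidiagonal (i + j) := mem_antidiagonal.2 rfl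
    rw [coeff_lowQuot_mul_lowQuot_sub K ρ (by dsimp; omega), coeff_mul,
      ← Finset.add_sum_erase _ _ hz']
    have h0 : coeff 0 (seriesInv K ρ x) = 1 := by simp [seriesInv]
    have e : ∀ a b c d : FreeAlgebra K (RankLetter ρ),
        -((a + b) * 1 + c) * d + b * d = -(a * (1 * d) + c * d) := by
      intro a b c d
      simp only [neg_mul, add_mul, mul_one, one_mul]
      abel
    simp only [series, coeff_mk, map_add (coeff (i + j)), h0]
    rw [e, neg_mem_iff]
    refine add_mem ?_ ?_
    · have := coeff_lowQuot_mul_remainder_mul_mem_relSpan K ρ (p := i + j) (q := 0) (r := m)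
        hux hv hu hi hj hm rfl le_rfl
      rwa [h0] at this
    · rw [Finset.sum_mul]
      refine Submodule.sum_mem _ fun z hz => ?_
      obtain ⟨hz, hz'⟩ := Finset.mem_erase.1 hz
      refine key (i + j, m) hm' z hz' le_rfl ?_
      have hz' := mem_antidiagonal.1 hz'
      have hne : z.1 ≠ i + j := fun h0 => hz (Prod.ext h0 (by simp; omega))
      omega
  · obtain ⟨hy, hy'⟩ := Finset.mem_erase.1 hy
    have hys := mem_antidiagonal.1 hy'
    have hne : y.1 ≠ i + j := fun h0 => hy (Prod.ext h0 (by simp; omega))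
    rcases Nat.lt_or_ge (i + j) y.1 with h₁ | h₁
    · rw [coeff_lowQuot_mul_lowQuot_sub_of_lt K ρ (by omega) (by omega) (by omega), zero_mul]
      exact zero_mem _
    · rw [coeff_lowQuot_mul_lowQuot_sub K ρ (by omega), neg_mul,
        neg_mem_iff, coeff_mul, Finset.sum_mul, series, coeff_mk]
      refine Submodule.sum_mem _ fun z hz => key y hy' z hz h₁ ?_
      have := mem_antidiagonal.1 hz
      omega

end overlap

/-- The ambiguity is $(\text{remainder of } v \text{ by } u)_{i+j}(x,m)-(v,i)(\text{remainder of } u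
\text{ by } x)_{j+m}$. The degree $i+j+m$ part of `lowQuot_mul_remainder_add` rewrites it as `m₁ +
m₂ + m₃ - m₄`, each of weight below that of the overlap. -/
theorem system_resolvable : (system K ρ).Resolvable := by
  rintro a b c ⟨hvu, hv⟩ ⟨hux, hu⟩
  obtain ⟨⟨v, i⟩, hi, hi'⟩ := a
  obtain ⟨⟨u, j⟩, hj, hj'⟩ := b
  obtain ⟨⟨x, m⟩, hm, hm'⟩ := c
  dsimp only at hvu hv hux hu hi hi' hj hj' hm hm'
  have hw := letterWeight_pos (s := ρ v) hi
  have hw' := letterWeight_pos (s := ρ u) hj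
  have hw'' := letterWeight_pos (s := ρ x) hm
  refine ⟨letterWeight (ρ v) i + letterWeight (ρ u) j + letterWeight (ρ x) m - 1, by
    simp only [system]; omega, ?_⟩
  have e := congrArg (coeff (i + j + m)) (lowQuot_mul_remainder_add K ρ v u x)
  rw [map_add, map_add] at e
  have m₁ := coeff_lowQuot_mul_remainder_sub_mem_relSpan K ρ hux hv hu hi hj hm
  have m₂ := coeff_seriesInv_mul_elem_sub_mem_relSpan K ρ hvu hux hv hu hi hj hm
  have m₃ := (system K ρ).relSpan_mono (r' := letterWeight (ρ v) i + letterWeight (ρ u) j +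
    letterWeight (ρ x) m - 1) ?_
    (coeff_remainder_mem_relSpan K ρ hvu (by omega) (i + j + m))
  have m₄ := (system K ρ).relSpan_mono (r' := letterWeight (ρ v) i + letterWeight (ρ u) j +
    letterWeight (ρ x) m - 1) ?_
    (coeff_remainder_mem_relSpan K ρ (hux.trans hvu) (by omega) (i + j + m))
  · have := sub_mem (add_mem (add_mem m₁ m₂) m₃) m₄
    rw [← e] at this
    convert this using 1
    have h₂ : ∀ a b : RankLetter ρ, mon K [a, b] =
        elem K ρ a.1.1 a.1.2 * elem K ρ b.1.1 b.1.2 := fun a b => by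
      rw [mon_cons, elem_letter, elem_letter]
    rw [← elem_letter K ρ ⟨(v, i), hi, hi'⟩, ← elem_letter K ρ ⟨(x, m), hm, hm'⟩]
    simp only [system]
    rw [h₂, h₂, add_mul, mul_add, mul_assoc]
    abel
  · rw [show ρ v - ρ x = i + j by omega, Nat.add_sub_cancel_left]
    have e₁ := letterWeight_add (ρ u - j) i j hi
    have e₂ := letterWeight_self_add (ρ u - j) j hj
    rw [Nat.sub_add_cancel hj'] at e₁ e₂
    rw [hv, e₁, e₂]
    omega
  · rw [show ρ v - ρ u = i by omega, show i + j + m - i = j + m by omega]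
    have e₁ := letterWeight_add (ρ x - m) j m hj
    have e₂ := letterWeight_self_add (ρ x - m) m hm
    rw [Nat.sub_add_cancel hm'] at e₁ e₂
    rw [hu, e₁, e₂]
    omega

end RankLetter

/-! ### Independence of the irreducible words modulo the rules. -/

namespace QuadraticRewriting

variable {k L : Type*} [Field k] (S : QuadraticRewriting k L)

/-- The largest two-sided ideal killed by the normal form map. -/
noncomputable def ideal : Ideal (FreeAlgebra k L) where
  carrier := {x | ∀ a b, S.nf (a * x * b) = 0}
  zero_mem' := by simp
  add_mem' hx hy a b := by rw [mul_add, add_mul, map_add, hx, hy, add_zero]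
  smul_mem' c x hx a b := by rw [smul_eq_mul, ← mul_assoc, hx]

instance : S.ideal.IsTwoSided where
  mul_mem_of_left b hx c d := by rw [← mul_assoc, mul_assoc _ b d, hx]

variable {S}

theorem nf_eq_zero_of_mem_ideal {x : FreeAlgebra k L} (hx : x ∈ S.ideal) : S.nf x = 0 := by
  simpa using hx 1 1

theorem mem_ideal_of_mem_relSpan (hS : S.Decreasing) (hS' : S.Resolvable) {r : ℕ}
    {x : FreeAlgebra k L} (hx : x ∈ S.relSpan r) : x ∈ S.ideal := by
  induction hx using Submodule.span_induction with
  | mem x hx =>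
    obtain ⟨p, a, b, q, h, -, rfl⟩ := hx
    intro c d
    have := nf_mul_sub_mul hS hS' h (c * mon k p) (mon k q * d)
    simpa only [mul_assoc] using this
  | zero => exact zero_mem _
  | add x y _ _ hx hy => exact add_mem hx hy
  | smul c x _ hx =>
    intro a b
    rw [mul_smul_comm, smul_mul_assoc, map_smul, hx, smul_zero]

/-- The irreducible words are linearly independent modulo the ideal. -/
theorem linearIndependent_irred :
    LinearIndependent k fun l : {l // S.Irred l} => Ideal.Quotient.mkₐ k S.ideal (mon k l.1) := by
  have hli : LinearIndependent k fun l : {l // S.Irred l} => (mon k l.1 : FreeAlgebra k L) := by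
    have h := (FreeAlgebra.basisFreeMonoid k L).linearIndependent.comp
      (fun l : {l // S.Irred l} => FreeMonoid.ofList l.1)
      (FreeMonoid.ofList.injective.comp Subtype.val_injective)
    simpa only [Function.comp_def, basisFreeMonoid_apply] using h
  refine linearIndependent_iff.2 fun c hc => linearIndependent_iff.1 hli c ?_
  have hm := Finsupp.apply_linearCombination k (Ideal.Quotient.mkₐ k S.ideal).toLinearMap
    (fun l : {l // S.Irred l} => (mon k l.1 : FreeAlgebra k L)) c
  replace hc := hm.trans hc
  -- The normal form kills the ideal but fixes irreducible words, so the combination already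
  -- vanishes in the free algebra.
  have hc' := nf_eq_zero_of_mem_ideal (Ideal.Quotient.eq_zero_iff_mem.1 hc)
  rw [← hc', Finsupp.linearCombination_apply, Finsupp.sum, map_sum]
  refine Finset.sum_congr rfl fun l _ => ?_
  rw [map_smul, nf_mon_of_irred _ l.2]

end QuadraticRewriting

namespace RankLetter

open PowerSeries

theorem coeff_one_mul_seriesInv (K : Type*) {V : Type*} [Field K] (ρ : V → ℕ) (v u : V) :
    coeff 1 (series K ρ v * seriesInv K ρ u) = elem K ρ v 1 - elem K ρ u 1 := by
  have hs : ∀ f g : (FreeAlgebra K (RankLetter ρ))⟦X⟧, constantCoeff f = 1 →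
      constantCoeff g = 1 → coeff 1 (f * g) = coeff 1 g + coeff 1 f := by
    intro f g hf hg
    rw [coeff_mul, show Finset.HasAntidiagonal.antidiagonal 1 = {((0 : ℕ), 1), (1, 0)} from rfl,
      Finset.sum_pair (by simp)]
    simp [hf, hg]
  have hi : constantCoeff (seriesInv K ρ u) = 1 := by simp [seriesInv]
  have h := congrArg (coeff 1) (series_mul_seriesInv K ρ u)
  rw [hs _ _ (constantCoeff_series K ρ u) hi, coeff_one, if_neg one_ne_zero] at h
  rw [hs _ _ (constantCoeff_series K ρ v) hi, eq_neg_of_add_eq_zero_left h]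
  simp only [series, coeff_mk]
  abel

end RankLetter

/-! ### Comparison of the path algebra with the rewriting quotient. -/

namespace LayeredGraph

open PowerSeries QuadraticRewriting RankLetter
open Finset.HasAntidiagonal (antidiagonal mem_antidiagonal)

variable {Γ : LayeredGraph}

theorem IsPath.append {u v w : Γ.V} {π π' : List Γ.E} (h : Γ.IsPath u π v) (h' : Γ.IsPath v π' w) :
    Γ.IsPath u (π ++ π') w := by
  induction π generalizing u with
  | nil => rwa [show u = v from h]
  | cons e π ih => exact ⟨h.1, ih h.2⟩

theorem IsPath.level {v w : Γ.V} {π : List Γ.E} (h : Γ.IsPath v π w) :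
    Γ.level v = Γ.level w + π.length := by
  induction π generalizing v with
  | nil => rw [show v = w from h]; rfl
  | cons e π ih =>
    rw [← h.1, Γ.level_tail, ih h.2, List.length_cons]
    rfl

/-- The reachability order on the vertices: `u ≤ v` if there is a path from `v` to `u`. -/
instance : Preorder Γ.V where
  le u v := ∃ π, Γ.IsPath v π u
  le_refl v := ⟨[], rfl⟩
  le_trans := fun _ _ _ ⟨_, h⟩ ⟨_, h'⟩ => ⟨_, h'.append h⟩

theorem level_lt_of_lt {u v : Γ.V} (h : u < v) : Γ.level u < Γ.level v := by
  obtain ⟨⟨π, hπ⟩, h'⟩ := h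
  rw [hπ.level]
  cases π with
  | nil => exact absurd ⟨[], (show v = u from hπ).symm⟩ h'
  | cons e π => simp

theorem lt_iff {u v : Γ.V} : u < v ↔ u ≤ v ∧ Γ.level u < Γ.level v := by
  refine ⟨fun h => ⟨h.le, level_lt_of_lt h⟩, fun h => lt_of_le_not_ge h.1 ?_⟩
  rintro ⟨π, hπ⟩
  have := hπ.level
  omega

variable (Γ) in
/-- The vertex of level `0`. -/
noncomputable def bot : Γ.V := Γ.existsUnique_level_zero.choose

theorem level_bot : Γ.level Γ.bot = 0 := Γ.existsUnique_level_zero.choose_spec.1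

theorem eq_bot {v : Γ.V} (h : Γ.level v = 0) : v = Γ.bot :=
  Γ.existsUnique_level_zero.choose_spec.2 v h

theorem exists_path_bot (v : Γ.V) : ∃ π, Γ.IsPath v π Γ.bot := by
  induction h : Γ.level v generalizing v with
  | zero => exact ⟨[], eq_bot h⟩
  | succ n ih =>
    obtain ⟨e, rfl⟩ := Γ.exists_edge v (by omega)
    obtain ⟨π, hπ⟩ := ih (Γ.head e) (by have := Γ.level_tail e; omega)
    exact ⟨e :: π, rfl, hπ⟩

/-- A path from `v` to the vertex of level `0`. -/
noncomputable def pathToBot (v : Γ.V) : List Γ.E := (exists_path_bot v).choose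

theorem isPath_pathToBot (v : Γ.V) : Γ.IsPath v (pathToBot v) Γ.bot :=
  (exists_path_bot v).choose_spec

theorem length_pathToBot (v : Γ.V) : (pathToBot v).length = Γ.level v := by
  rw [(isPath_pathToBot v).level, level_bot, zero_add]

section pathSeries

variable {k : Type*} [Field k] {R : Type*} [Ring R] [Algebra k R]

theorem pathElem_zero (π : List Γ.E) : pathElem k Γ π 0 = 1 := by
  simp [pathElem]

theorem pathElem_of_lt {π : List Γ.E} {j : ℕ} (h : π.length < j) : pathElem k Γ π j = 0 := by
  rw [pathElem, List.sublistsLen_of_length_lt h]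
  rfl

theorem pathElem_cons_succ (e : Γ.E) (π : List Γ.E) (j : ℕ) :
    pathElem k Γ (e :: π) (j + 1) =
      pathElem k Γ π (j + 1) + FreeAlgebra.ι k e * pathElem k Γ π j := by
  simp only [pathElem, List.sublistsLen_succ_cons, List.map_append, List.sum_append, List.map_map,
    Function.comp_def, List.map_cons, List.prod_cons, List.sum_map_mul_left]

/-- The generating function of the elements `e(π, j)`, evaluated by an algebra homomorphism. -/
noncomputable def pathSeries (f : FreeAlgebra k Γ.E →ₐ[k] R) (π : List Γ.E) : R⟦X⟧ :=
  PowerSeries.mk fun j => f (pathElem k Γ π j)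

theorem pathSeries_nil (f : FreeAlgebra k Γ.E →ₐ[k] R) : pathSeries f [] = 1 := by
  ext j
  rw [pathSeries, coeff_mk, coeff_one]
  cases j with
  | zero => simp [pathElem_zero]
  | succ j => rw [pathElem_of_lt (by simp), map_zero, if_neg (by simp)]

theorem pathSeries_cons (f : FreeAlgebra k Γ.E →ₐ[k] R) (e : Γ.E) (π : List Γ.E) :
    pathSeries f (e :: π) = (1 + C (f (FreeAlgebra.ι k e)) * X) * pathSeries f π := by
  ext j
  rw [add_mul, one_mul, mul_assoc, map_add, coeff_C_mul]
  cases j with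
  | zero => simp [pathSeries, pathElem_zero]
  | succ j => simp [pathSeries, pathElem_cons_succ, coeff_succ_X_mul]

theorem pathSeries_append (f : FreeAlgebra k Γ.E →ₐ[k] R) (π π' : List Γ.E) :
    pathSeries f (π ++ π') = pathSeries f π * pathSeries f π' := by
  induction π with
  | nil => rw [List.nil_append, pathSeries_nil, one_mul]
  | cons e π ih => rw [List.cons_append, pathSeries_cons, pathSeries_cons, ih, mul_assoc]

theorem pathSeries_eq {u v : Γ.V} {π π' : List Γ.E} (h : Γ.IsPath u π v) (h' : Γ.IsPath u π' v) :
    pathSeries (RingQuot.mkAlgHom k (Rel k Γ)) π = pathSeries (RingQuot.mkAlgHom k (Rel k Γ)) π' := by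
  have hl := h.level
  have hl' := h'.level
  ext j
  rw [pathSeries, pathSeries, coeff_mk, coeff_mk]
  rcases Nat.eq_zero_or_pos j with rfl | hj
  · rw [pathElem_zero, pathElem_zero]
  rcases Nat.lt_or_ge π.length j with h₁ | h₁
  · rw [pathElem_of_lt h₁, pathElem_of_lt (by omega)]
  · exact RingQuot.mkAlgHom_rel k (Rel.mk u v π π' h h' j hj h₁)

end pathSeries

variable (k : Type*) [Field k]

variable (Γ) in
/-- The homomorphism sending the letter `(v, i)` to `e(π, i)`, for the paths `π` from `v` to the
vertex of level `0`. -/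
noncomputable def letterHom : FreeAlgebra k (RankLetter Γ.level) →ₐ[k] Alg k Γ :=
  FreeAlgebra.lift k fun a =>
    RingQuot.mkAlgHom k (Rel k Γ) (pathElem k Γ (pathToBot a.1.1) a.1.2)

theorem letterHom_elem (v : Γ.V) (i : ℕ) :
    letterHom Γ k (elem k Γ.level v i) =
      RingQuot.mkAlgHom k (Rel k Γ) (pathElem k Γ (pathToBot v) i) := by
  rw [elem]
  split_ifs with h h'
  · rw [mon_singleton, letterHom, FreeAlgebra.lift_ι_apply]
  · rw [h', pathElem_zero, map_one, map_one]
  · rw [pathElem_of_lt (by rw [length_pathToBot]; omega), map_zero, map_zero]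

theorem map_series (v : Γ.V) :
    PowerSeries.map (letterHom Γ k : _ →+* Alg k Γ) (series k Γ.level v) =
      pathSeries (RingQuot.mkAlgHom k (Rel k Γ)) (pathToBot v) := by
  ext i
  simp [series, pathSeries, letterHom_elem]

/-- Following a path $\pi$ from `v` to `u` and then a path to the bottom gives $P_v=P_\pi P_u$. So
$P_vP_u^{-1}=P_\pi$ has degree at most the length of $\pi$, which is the rank difference; truncation
loses nothing and the remainder vanishes. -/
theorem letterHom_remainder {u v : Γ.V} (h : u < v) (n : ℕ) :
    letterHom Γ k (coeff n (remainder k Γ.level v u)) = 0 := by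
  obtain ⟨⟨π, hπ⟩, -⟩ := h
  have hs := pathSeries_eq (k := k) (isPath_pathToBot v) (hπ.append (isPath_pathToBot u))
  rw [pathSeries_append] at hs
  have hl := hπ.level
  have e₁ : PowerSeries.map (letterHom Γ k : _ →+* Alg k Γ)
      (series k Γ.level v * seriesInv k Γ.level u) =
      pathSeries (RingQuot.mkAlgHom k (Rel k Γ)) π := by
    have : PowerSeries.map (letterHom Γ k : _ →+* Alg k Γ) (series k Γ.level u) *
        PowerSeries.map (letterHom Γ k : _ →+* Alg k Γ) (seriesInv k Γ.level u) = 1 := by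
      rw [← map_mul, series_mul_seriesInv, map_one]
    rw [map_mul, map_series, hs, ← map_series, mul_assoc, this, mul_one]
  have e₂ : PowerSeries.map (letterHom Γ k : _ →+* Alg k Γ) (lowQuot k Γ.level v u) =
      pathSeries (RingQuot.mkAlgHom k (Rel k Γ)) π := by
    ext i
    rw [← e₁, coeff_map, coeff_map, lowQuot, coeff_mk]
    split_ifs with hi
    · rfl
    · rw [← coeff_map, e₁, pathSeries, coeff_mk, pathElem_of_lt (by omega), map_zero, map_zero]
  have : PowerSeries.map (letterHom Γ k : _ →+* Alg k Γ) (remainder k Γ.level v u) = 0 := by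
    rw [remainder, map_sub, map_mul, e₂, map_series, map_series, hs, sub_self]
  have := congrArg (coeff n) this
  rwa [coeff_map, map_zero] at this

theorem letterHom_rhs {a b : RankLetter Γ.level} (h : (system k Γ.level).red a b) :
    letterHom Γ k (mon k [a, b]) = letterHom Γ k ((system k Γ.level).rhs a b) := by
  rw [system, map_add, letterHom_remainder k h.1, add_zero]

/-- The quotient of the free algebra on the letters by the rewriting rules. -/
abbrev LetterAlg (Γ : LayeredGraph) : Type _ :=
  FreeAlgebra k (RankLetter Γ.level) ⧸ (system k Γ.level).ideal

variable (Γ) in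
/-- The quotient map to `LetterAlg`. -/
noncomputable abbrev letterMk : FreeAlgebra k (RankLetter Γ.level) →ₐ[k] LetterAlg k Γ :=
  Ideal.Quotient.mkₐ k (system k Γ.level).ideal

variable (Γ) in
/-- The generating function of the letters at `v`, in `LetterAlg`. -/
noncomputable def letterSeries (v : Γ.V) : (LetterAlg k Γ)⟦X⟧ :=
  PowerSeries.map (letterMk Γ k : _ →+* LetterAlg k Γ) (series k Γ.level v)

variable (Γ) in
/-- The homomorphism to `LetterAlg` sending an edge from `v` to `w` to `(v, 1) - (w, 1)`. -/
noncomputable def edgeHom : FreeAlgebra k Γ.E →ₐ[k] LetterAlg k Γ :=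
  FreeAlgebra.lift k fun e =>
    letterMk Γ k (elem k Γ.level (Γ.tail e) 1 - elem k Γ.level (Γ.head e) 1)

theorem head_lt_tail (e : Γ.E) : Γ.head e < Γ.tail e :=
  lt_iff.2 ⟨⟨[e], rfl, rfl⟩, by have := Γ.level_tail e; omega⟩

/-- Along an edge the rank drops by one, so the truncated quotient is linear, and the vanishing
remainder is this factorization. -/
theorem edgeHom_series (e : Γ.E) :
    (1 + C (edgeHom Γ k (FreeAlgebra.ι k e)) * X) * letterSeries Γ k (Γ.head e) =
      letterSeries Γ k (Γ.tail e) := by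
  have hl := Γ.level_tail e
  have h : PowerSeries.map (letterMk Γ k : _ →+* LetterAlg k Γ)
      (remainder k Γ.level (Γ.tail e) (Γ.head e)) = 0 := by
    ext n
    rw [coeff_map, map_zero]
    exact Ideal.Quotient.eq_zero_iff_mem.2 (mem_ideal_of_mem_relSpan (system_decreasing k Γ.level)
      (system_resolvable k Γ.level)
      (coeff_remainder_mem_relSpan k Γ.level (head_lt_tail e) (by omega) n))
  have h' : lowQuot k Γ.level (Γ.tail e) (Γ.head e) =
      1 + C (elem k Γ.level (Γ.tail e) 1 - elem k Γ.level (Γ.head e) 1) * X := by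
    ext n
    match n with
    | 0 => simp [lowQuot, series, seriesInv]
    | 1 =>
      rw [lowQuot, coeff_mk, if_pos (by omega), coeff_one_mul_seriesInv, map_add, coeff_one,
        if_neg one_ne_zero, zero_add, coeff_C_mul, coeff_one_X, mul_one]
    | n + 2 =>
      rw [coeff_lowQuot_of_lt k Γ.level (by omega), map_add, coeff_one, if_neg (by simp),
        coeff_C_mul, coeff_X, if_neg (by simp), mul_zero, add_zero]
  rw [remainder, map_sub, map_mul, h', sub_eq_zero] at h
  rw [letterSeries, letterSeries, h, map_add, map_mul, map_one, map_X, map_C, edgeHom,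
    FreeAlgebra.lift_ι_apply]
  rfl

theorem pathSeries_edgeHom {v w : Γ.V} {π : List Γ.E} (h : Γ.IsPath v π w) :
    pathSeries (edgeHom Γ k) π * letterSeries Γ k w = letterSeries Γ k v := by
  induction π generalizing v with
  | nil => rw [pathSeries_nil, one_mul, show v = w from h]
  | cons e π ih => rw [pathSeries_cons, mul_assoc, ih h.2, edgeHom_series, h.1]

/-- Both path series, multiplied by the invertible series at `w`, give the series at `v`. -/
theorem pathSeries_edgeHom_eq {v w : Γ.V} {π π' : List Γ.E} (h : Γ.IsPath v π w)
    (h' : Γ.IsPath v π' w) : pathSeries (edgeHom Γ k) π = pathSeries (edgeHom Γ k) π' := by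
  have e : letterSeries Γ k w * PowerSeries.map (letterMk Γ k : _ →+* LetterAlg k Γ)
      (seriesInv k Γ.level w) = 1 := by
    rw [letterSeries, ← map_mul, series_mul_seriesInv, map_one]
  rw [← mul_one (pathSeries _ π), ← mul_one (pathSeries _ π'), ← e, ← mul_assoc, ← mul_assoc,
    pathSeries_edgeHom k h, pathSeries_edgeHom k h']

variable (Γ) in
/-- The homomorphism from `A(Γ)` to `LetterAlg`. -/
noncomputable def toLetterAlg : Alg k Γ →ₐ[k] LetterAlg k Γ :=
  RingQuot.liftAlgHom k ⟨edgeHom Γ k, by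
    rintro _ _ ⟨v, w, π, π', h, h', j, -, -⟩
    have := congrArg (coeff j) (pathSeries_edgeHom_eq k h h')
    rwa [pathSeries, pathSeries, coeff_mk, coeff_mk] at this⟩

/-- A path from `v` to the bottom telescopes to the series at `v`, because the series at the bottom
vertex is $1$. This one-sided inverse suffices to transport linear independence. -/
theorem toLetterAlg_letterHom (x : FreeAlgebra k (RankLetter Γ.level)) :
    toLetterAlg Γ k (letterHom Γ k x) = letterMk Γ k x := by
  suffices (toLetterAlg Γ k).comp (letterHom Γ k) = letterMk Γ k from DFunLike.congr_fun this x
  ext a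
  have e := congrArg (coeff a.1.2) (pathSeries_edgeHom k (isPath_pathToBot a.1.1))
  have hb : letterSeries Γ k Γ.bot = 1 := by
    have : series k Γ.level Γ.bot = 1 := by
      ext i
      rw [series, coeff_mk, coeff_one]
      split_ifs with h
      · rw [h, elem_zero]
      · rw [elem_of_lt _ _ (by rw [level_bot]; omega)]
    rw [letterSeries, this, map_one]
  rw [hb, mul_one, letterSeries, pathSeries, series, coeff_map, coeff_mk, coeff_mk,
    elem_letter, mon_singleton] at e
  simpa [letterHom, toLetterAlg] using e

end LayeredGraph

/-! ### Bases of the homogeneous components and traces on them. -/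

namespace QuadraticRewriting

variable {k L : Type*} [Field k]

theorem finite_setOf_wdeg_eq [Finite L] (S : QuadraticRewriting k L) (hS : ∀ a, 1 ≤ S.deg a)
    (d : ℕ) : {l | S.wdeg l = d}.Finite := by
  refine (List.finite_length_le L d).subset fun l hl => ?_
  have h : ∀ l : List L, l.length ≤ S.wdeg l := fun l => by
    induction l with
    | nil => simp
    | cons a l ih =>
      have := hS a
      simp
      omega
  exact (h l).trans hl.le

end QuadraticRewriting

namespace LayeredGraph

open PowerSeries QuadraticRewriting RankLetter

variable {Γ : LayeredGraph} (k : Type*) [Field k]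

theorem letterHom_edge (e : Γ.E) :
    letterHom Γ k (elem k Γ.level (Γ.tail e) 1 - elem k Γ.level (Γ.head e) 1) = edge k Γ e := by
  have h := congrArg (coeff 1) (pathSeries_eq (k := k) (isPath_pathToBot (Γ.tail e))
    (π' := e :: pathToBot (Γ.head e)) ⟨rfl, isPath_pathToBot _⟩)
  rw [pathSeries, pathSeries, coeff_mk, coeff_mk, pathElem_cons_succ, pathElem_zero, mul_one] at h
  rw [map_sub, letterHom_elem, letterHom_elem, h, map_add, zero_add, add_sub_cancel_left]
  rfl

variable {k} in
theorem mul_mem_component {d d' : ℕ} {x y : Alg k Γ} (hx : x ∈ component k Γ d)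
    (hy : y ∈ component k Γ d') : x * y ∈ component k Γ (d + d') := by
  have := Submodule.mul_mem_mul hx hy
  rw [component, component, Submodule.span_mul_span] at this
  refine Submodule.span_mono ?_ this
  rintro _ ⟨_, ⟨l, hl, rfl⟩, _, ⟨l', hl', rfl⟩, rfl⟩
  exact ⟨l ++ l', by simp [hl, hl'], by simp⟩

theorem one_mem_component : (1 : Alg k Γ) ∈ component k Γ 0 :=
  Submodule.subset_span ⟨[], rfl, rfl⟩

theorem pathElem_mem_component (π : List Γ.E) (j : ℕ) :
    RingQuot.mkAlgHom k (Rel k Γ) (pathElem k Γ π j) ∈ component k Γ j := by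
  rw [pathElem, map_list_sum]
  refine list_sum_mem fun x hx => ?_
  simp only [List.mem_map, List.mem_sublistsLen] at hx
  obtain ⟨_, ⟨l, ⟨-, hl⟩, rfl⟩, rfl⟩ := hx
  refine Submodule.subset_span ⟨l, hl, ?_⟩
  rw [map_list_prod, List.map_map]
  rfl

theorem letterHom_mon_mem_component (l : List (RankLetter Γ.level)) :
    letterHom Γ k (mon k l) ∈ component k Γ ((system k Γ.level).wdeg l) := by
  induction l with
  | nil => simpa using one_mem_component k
  | cons a l ih =>
    rw [mon_cons, map_mul, wdeg_cons]
    refine mul_mem_component ?_ ih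
    rw [← elem_letter, letterHom_elem]
    exact pathElem_mem_component k _ _

/-- An edge is the difference of the degree-one letters at its ends, so `letterHom` reaches every
word of edges in the right degree. The weight bound `r` plays no role. -/
theorem exists_fil_of_component (l : List Γ.E) :
    ∃ r, ∃ x ∈ (system k Γ.level).fil l.length r,
      letterHom Γ k x = (l.map (edge k Γ)).prod := by
  induction l with
  | nil => exact ⟨0, 1, one_mem_fil k _, by simp⟩
  | cons e l ih =>
    obtain ⟨r, x, hx, h⟩ := ih
    have h₁ := (system k Γ.level).fil_mono (le_max_left _
      (letterWeight (Γ.level (Γ.head e)) 1)) (elem_mem_fil k Γ.level (Γ.tail e) 1)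
    have h₂ := (system k Γ.level).fil_mono (le_max_right
      (letterWeight (Γ.level (Γ.tail e)) 1) _) (elem_mem_fil k Γ.level (Γ.head e) 1)
    have := (system k Γ.level).mul_mem_fil (sub_mem h₁ h₂) hx
    rw [add_comm 1] at this
    refine ⟨_, _, this, ?_⟩
    rw [map_mul, letterHom_edge, h, List.map_cons, List.prod_cons]

/-- The irreducible words of degree `d`. -/
abbrev IrredWord (Γ : LayeredGraph) (d : ℕ) : Type _ :=
  {l : List (RankLetter Γ.level) // (system k Γ.level).Irred l ∧ (system k Γ.level).wdeg l = d}

theorem component_eq_span (d : ℕ) :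
    component k Γ d =
      Submodule.span k (Set.range fun l : IrredWord k Γ d => letterHom Γ k (mon k l.1)) := by
  apply le_antisymm
  · refine Submodule.span_le.2 ?_
    rintro _ ⟨l, rfl, rfl⟩
    obtain ⟨r, x, hx, h⟩ := exists_fil_of_component k l
    rw [← h]
    suffices h : (system k Γ.level).fil l.length r ≤ Submodule.comap (letterHom Γ k).toLinearMap
      (Submodule.span k (Set.range fun l' : IrredWord k Γ l.length =>
        letterHom Γ k (mon k l'.1))) from h hx
    refine Submodule.span_le.2 ?_
    rintro _ ⟨l', ⟨hl', -⟩, rfl⟩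
    have := map_mon_mem_span_irred (system_decreasing k Γ.level) (letterHom Γ k)
      (fun a b => letterHom_rhs k) l'
    refine Submodule.span_mono ?_ this
    rintro _ ⟨l'', ⟨h₁, h₂⟩, rfl⟩
    exact ⟨⟨l'', h₁, h₂.trans hl'⟩, rfl⟩
  · refine Submodule.span_le.2 ?_
    rintro _ ⟨⟨l, h, rfl⟩, rfl⟩
    exact letterHom_mon_mem_component k l

theorem linearIndependent_letterHom (d : ℕ) :
    LinearIndependent k fun l : IrredWord k Γ d => letterHom Γ k (mon k l.1) := by
  refine LinearIndependent.of_comp (toLetterAlg Γ k).toLinearMap ?_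
  have h := (linearIndependent_irred (S := system k Γ.level)).comp
    (fun l : IrredWord k Γ d => (⟨l.1, l.2.1⟩ : {l // (system k Γ.level).Irred l}))
    (fun l l' h => by simpa [Subtype.ext_iff] using h)
  have e : ((toLetterAlg Γ k).toLinearMap ∘ fun l : IrredWord k Γ d => letterHom Γ k (mon k l.1)) =
      fun l => letterMk Γ k (mon k l.1) :=
    funext fun l => toLetterAlg_letterHom k (mon k l.1)
  rw [e]
  exact h

variable (Γ) in
/-- The basis of `A(Γ)_[d]` given by the irreducible words. -/
noncomputable def componentBasis (d : ℕ) : Module.Basis (IrredWord k Γ d) k (component k Γ d) :=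
  (Module.Basis.span (linearIndependent_letterHom k d)).map
    (LinearEquiv.ofEq _ _ (component_eq_span k d).symm)

theorem componentBasis_apply (d : ℕ) (l : IrredWord k Γ d) :
    (componentBasis Γ k d l : Alg k Γ) = letterHom Γ k (mon k l.1) := by
  rw [componentBasis, Module.Basis.map_apply, LinearEquiv.coe_ofEq_apply, Module.Basis.span_apply]

instance [Finite Γ.V] : Finite (RankLetter Γ.level) := by
  obtain ⟨N, hN⟩ := Γ.exists_bound
  have : Finite (Γ.V × Fin (N + 1)) := inferInstance
  refine Finite.of_injective
    (fun a : RankLetter Γ.level => (a.1.1, (⟨a.1.2, by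
      have := a.2.2; have := hN a.1.1; omega⟩ : Fin (N + 1)))) fun a b h => ?_
  simp only [Prod.mk.injEq, Fin.mk.injEq] at h
  exact Subtype.ext (Prod.ext h.1 h.2)

instance [Finite Γ.V] (d : ℕ) : Finite (IrredWord k Γ d) :=
  ((finite_setOf_wdeg_eq (system k Γ.level) (fun a => a.2.1) d).subset fun _ h => h.2).to_subtype

theorem finite_component [Finite Γ.V] (d : ℕ) : Module.Finite k (component k Γ d) :=
  .of_basis (componentBasis Γ k d)

theorem finrank_component (d : ℕ) :
    Module.finrank k (component k Γ d) = Nat.card (IrredWord k Γ d) :=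
  Module.finrank_eq_nat_card_basis (componentBasis Γ k d)

namespace Aut

variable (φ : Γ.Aut)

/-- The inverse automorphism. -/
def symm : Γ.Aut where
  onV := φ.onV.symm
  onE := φ.onE.symm
  tail_onE e := by rw [Equiv.eq_symm_apply, ← φ.tail_onE, Equiv.apply_symm_apply]
  head_onE e := by rw [Equiv.eq_symm_apply, ← φ.head_onE, Equiv.apply_symm_apply]
  level_onV v := by rw [← φ.level_onV, Equiv.apply_symm_apply]

theorem onV_le {u v : Γ.V} (h : u ≤ v) : φ.onV u ≤ φ.onV v := by
  obtain ⟨π, hπ⟩ := h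
  exact ⟨_, φ.isPath_map _ _ _ hπ⟩

theorem onV_lt_iff {u v : Γ.V} : φ.onV u < φ.onV v ↔ u < v := by
  rw [lt_iff, lt_iff, φ.level_onV, φ.level_onV]
  refine and_congr_left fun _ => ⟨fun h => ?_, φ.onV_le⟩
  have := φ.symm.onV_le h
  simpa [symm] using this

theorem onV_bot : φ.onV Γ.bot = Γ.bot := eq_bot (by rw [φ.level_onV, level_bot])

/-- The action of an automorphism on the letters. -/
def onLetter (a : RankLetter Γ.level) : RankLetter Γ.level :=
  ⟨(φ.onV a.1.1, a.1.2), by simpa [φ.level_onV] using a.2⟩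

theorem onLetter_eq_self_iff (a : RankLetter Γ.level) : φ.onLetter a = a ↔ φ.onV a.1.1 = a.1.1 := by
  refine ⟨fun h => congrArg (fun a => a.1.1) h, fun h => Subtype.ext (Prod.ext h rfl)⟩

/-- The image of a path from `v` to the bottom is another path from the image of `v` to the bottom,
and its elements $e(\pi,i)$ do not depend on the choice. -/
theorem algHom_letterHom_mon (l : List (RankLetter Γ.level)) :
    φ.algHom k (letterHom Γ k (mon k l)) = letterHom Γ k (mon k (l.map φ.onLetter)) := by
  induction l with
  | nil => simp
  | cons a l ih =>
    rw [List.map_cons, mon_cons, mon_cons (φ.onLetter a), map_mul, map_mul, map_mul, ih]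
    congr 1
    rw [← elem_letter, ← elem_letter, letterHom_elem, letterHom_elem]
    have h := φ.isPath_map _ _ _ (isPath_pathToBot a.1.1)
    rw [onV_bot] at h
    have e := congrArg (coeff a.1.2) (pathSeries_eq (k := k) h
      (isPath_pathToBot (φ.onV a.1.1)))
    rw [pathSeries, pathSeries, coeff_mk, coeff_mk] at e
    rw [algHom, RingQuot.liftAlgHom_mkAlgHom_apply, lift_pathElem, e]
    rfl

theorem wdeg_map_onLetter (l : List (RankLetter Γ.level)) :
    (system k Γ.level).wdeg (l.map φ.onLetter) = (system k Γ.level).wdeg l := by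
  rw [wdeg, List.map_map]
  rfl

theorem irred_map_onLetter (l : List (RankLetter Γ.level)) :
    (system k Γ.level).Irred (l.map φ.onLetter) ↔ (system k Γ.level).Irred l := by
  rw [Irred, List.isChain_map]
  have : ∀ a b, (system k Γ.level).red (φ.onLetter a) (φ.onLetter b) ↔
      (system k Γ.level).red a b := fun a b => by
    simp only [system, onLetter, φ.onV_lt_iff, φ.level_onV]
  simp only [this, Irred]

theorem onComponent_componentBasis (d : ℕ) (l : IrredWord k Γ d) :
    φ.onComponent k d (componentBasis Γ k d l) =
      componentBasis Γ k d ⟨l.1.map φ.onLetter, (φ.irred_map_onLetter k l.1).2 l.2.1,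
        (φ.wdeg_map_onLetter k l.1).trans l.2.2⟩ := by
  apply Subtype.ext
  rw [componentBasis_apply]
  change φ.algHom k (componentBasis Γ k d l : Alg k Γ) = _
  rw [componentBasis_apply, algHom_letterHom_mon]

/-- The trace on `A(Γ)_[d]` is the number of irreducible words of degree `d` all of whose letters
are fixed. -/
theorem trace_onComponent [Finite Γ.V] (d : ℕ) :
    LinearMap.trace k (component k Γ d) (φ.onComponent k d) =
      (Nat.card {l : List (RankLetter Γ.level) // (system k Γ.level).Irred l ∧
        (system k Γ.level).wdeg l = d ∧ ∀ a ∈ l, φ.onV a.1.1 = a.1.1} : k) := by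
  classical
  have := Fintype.ofFinite (IrredWord k Γ d)
  have hfix : ∀ l : List (RankLetter Γ.level),
      l.map φ.onLetter = l ↔ ∀ a ∈ l, φ.onV a.1.1 = a.1.1 := fun l => by
    conv_lhs => rw [← List.map_id l, List.map_map]
    rw [List.map_inj_left]
    simp [onLetter_eq_self_iff]
  rw [LinearMap.trace_eq_matrix_trace k (componentBasis Γ k d), Matrix.trace]
  have hdiag : ∀ l : IrredWord k Γ d,
      Matrix.diag (LinearMap.toMatrix (componentBasis Γ k d) (componentBasis Γ k d)
        (φ.onComponent k d)) l = if ∀ a ∈ l.1, φ.onV a.1.1 = a.1.1 then 1 else 0 := fun l => by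
    rw [Matrix.diag_apply, LinearMap.toMatrix_apply, onComponent_componentBasis,
      Module.Basis.repr_self, Finsupp.single_apply]
    refine if_congr ?_ rfl rfl
    rw [← hfix, Subtype.ext_iff]
  rw [Finset.sum_congr rfl fun l _ => hdiag l, Finset.sum_boole]
  congr 1
  rw [← Fintype.card_subtype, ← Nat.card_eq_fintype_card]
  refine Nat.card_congr ((Equiv.subtypeSubtypeEquivSubtypeInter
    (fun l => (system k Γ.level).Irred l ∧ (system k Γ.level).wdeg l = d)
    (fun l => ∀ a ∈ l, φ.onV a.1.1 = a.1.1)).trans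
    (Equiv.subtypeEquivRight fun l => and_assoc))

end Aut

end LayeredGraph

/-! ### Counting irreducible words by their first letter. -/

namespace QuadraticRewriting

open PowerSeries

variable {k L : Type*} [Field k] (S : QuadraticRewriting k L) (F : L → Prop)

/-- The irreducible words of degree `d` with letters in `F`. -/
def wordSet (d : ℕ) : Set (List L) := {l | S.Irred l ∧ S.wdeg l = d ∧ ∀ a ∈ l, F a}

/-- The generating function of the irreducible words with letters in `F`. -/
noncomputable def wordSeries (R : Type*) [CommRing R] : R⟦X⟧ :=
  PowerSeries.mk fun d => ((S.wordSet F d).ncard : R)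

/-- The generating function of the irreducible words with letters in `F` and first letter `a`. -/
noncomputable def headSeries (R : Type*) [CommRing R] (a : L) : R⟦X⟧ :=
  PowerSeries.mk fun d => ({l ∈ S.wordSet F d | l.head? = some a}.ncard : R)

theorem _root_.Set.ncard_eq_add_sum_head [Fintype L] {W : Set (List L)} (hW : W.Finite) :
    W.ncard = {l ∈ W | l = []}.ncard + ∑ a, {l ∈ W | l.head? = some a}.ncard := by
  classical
  have h : ∀ o : Option L,
      {l ∈ W | l.head? = o}.ncard = (hW.toFinset.filter fun l => l.head? = o).card := fun o => by
    rw [← Set.ncard_coe_finset]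
    congr 1
    ext l
    simp
  rw [Set.ncard_eq_toFinset_card W hW, Finset.card_eq_sum_card_fiberwise (f := List.head?)
    (t := Finset.univ) (by simp), Fintype.sum_option, ← h]
  simp only [← h, List.head?_eq_none_iff]

theorem irred_cons_iff {a : L} {l : List L} :
    S.Irred (a :: l) ↔ S.Irred l ∧ ¬ ∃ b, l.head? = some b ∧ S.red a b := by
  cases l with
  | nil => simp [Irred]
  | cons b l => simp [Irred, List.isChain_cons_cons, and_comm]

variable {S F}

theorem wordSet_finite [Finite L] (hS : ∀ a, 1 ≤ S.deg a) (d : ℕ) : (S.wordSet F d).Finite :=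
  (finite_setOf_wdeg_eq S hS d).subset fun _ h => h.2.1

theorem wordSeries_eq [Fintype L] (hS : ∀ a, 1 ≤ S.deg a) (R : Type*) [CommRing R] :
    S.wordSeries F R = 1 + ∑ a, S.headSeries F R a := by
  ext d
  rw [wordSeries, coeff_mk, Set.ncard_eq_add_sum_head (wordSet_finite hS d), map_add, map_sum,
    coeff_one]
  simp only [headSeries, coeff_mk]
  push_cast
  congr 1
  split_ifs with h
  · have : {l ∈ S.wordSet F d | l = []} = {[]} := by
      ext l
      simp only [Set.mem_ofPred_eq, Set.mem_singleton_iff, and_iff_right_iff_imp]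
      rintro rfl
      exact ⟨List.IsChain.nil, h.symm, by simp⟩
    rw [this, Set.ncard_singleton, Nat.cast_one]
  · have : {l ∈ S.wordSet F d | l = []} = ∅ := by
      ext l
      simp only [Set.mem_ofPred_eq, Set.mem_empty_iff_false, iff_false, not_and]
      rintro hl rfl
      exact h hl.2.1.symm
    rw [this, Set.ncard_empty, Nat.cast_zero]

theorem headSeries_eq_zero {a : L} (ha : ¬ F a) (R : Type*) [CommRing R] :
    S.headSeries F R a = 0 := by
  ext d
  have : {l ∈ S.wordSet F d | l.head? = some a} = ∅ := by
    ext l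
    simp only [Set.mem_ofPred_eq, Set.mem_empty_iff_false, iff_false, not_and]
    exact fun hl h => ha (hl.2.2 a (List.mem_of_mem_head? h))
  rw [headSeries, coeff_mk, this, Set.ncard_empty, Nat.cast_zero, map_zero]

-- Deleting the first letter `a` matches words starting with `a` to the words, of degree smaller by
-- `S.deg a`, that do not begin with some `b` reducible after `a`. The sum over `b` restores the
-- excluded words.
open Classical in
theorem headSeries_add [Fintype L] (hS : ∀ a, 1 ≤ S.deg a) {a : L} (ha : F a) (R : Type*)
    [CommRing R] :
    S.headSeries F R a +
        X ^ S.deg a * ∑ b, (if S.red a b then S.headSeries F R b else 0) =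
      X ^ S.deg a * S.wordSeries F R := by
  ext d
  rw [map_add, coeff_X_pow_mul', coeff_X_pow_mul', headSeries, coeff_mk]
  split_ifs with h
  · obtain ⟨e, rfl⟩ := Nat.exists_eq_add_of_le h
    rw [Nat.add_sub_cancel_left]
    have hfin := wordSet_finite (F := F) hS e
    have h₁ : {l ∈ S.wordSet F (S.deg a + e) | l.head? = some a}.ncard =
        {l ∈ S.wordSet F e | ¬ ∃ b, l.head? = some b ∧ S.red a b}.ncard := by
      symm
      rw [← Set.ncard_image_of_injective _ (List.cons_injective (a := a))]
      congr 1
      ext l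
      simp only [Set.mem_ofPred_eq, Set.mem_image]
      constructor
      · rintro ⟨l, ⟨⟨h₁, h₂, h₃⟩, h₄⟩, rfl⟩
        refine ⟨⟨(S.irred_cons_iff).2 ⟨h₁, h₄⟩, by rw [wdeg_cons, h₂], ?_⟩, rfl⟩
        simpa [ha] using h₃
      · rintro ⟨⟨h₁, h₂, h₃⟩, h₄⟩
        cases l with
        | nil => simp at h₄
        | cons b l =>
          obtain rfl : b = a := by simpa using h₄
          rw [irred_cons_iff] at h₁
          refine ⟨l, ⟨⟨h₁.1, ?_, fun c hc => h₃ c (List.mem_cons_of_mem _ hc)⟩, h₁.2⟩, rfl⟩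
          rw [wdeg_cons] at h₂
          omega
    have h₂ : {l ∈ S.wordSet F e | ∃ b, l.head? = some b ∧ S.red a b}.ncard =
        ∑ b, if S.red a b then {l ∈ S.wordSet F e | l.head? = some b}.ncard else 0 := by
      rw [Set.ncard_eq_add_sum_head (hfin.subset fun _ h => h.1)]
      have : {l ∈ {l ∈ S.wordSet F e | ∃ b, l.head? = some b ∧ S.red a b} | l = []} = ∅ := by
        ext l
        simp only [Set.mem_ofPred_eq, Set.mem_empty_iff_false, iff_false, not_and]
        rintro ⟨-, b, hb, -⟩ rfl
        simp at hb
      rw [this, Set.ncard_empty, zero_add]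
      refine Finset.sum_congr rfl fun b _ => ?_
      split_ifs with hb
      · congr 1
        ext l
        simp only [Set.mem_ofPred_eq]
        exact ⟨fun h => ⟨h.1.1, h.2⟩, fun h => ⟨⟨h.1, b, h.2, hb⟩, h.2⟩⟩
      · refine (congrArg Set.ncard ?_).trans (Set.ncard_empty _)
        ext l
        simp only [Set.mem_ofPred_eq, Set.mem_empty_iff_false, iff_false, not_and]
        rintro ⟨-, c, hc, hr⟩ h
        rw [h, Option.some_inj] at hc
        exact hb (hc ▸ hr)
    have h₃ : {l ∈ S.wordSet F e | ¬ ∃ b, l.head? = some b ∧ S.red a b}.ncard +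
        {l ∈ S.wordSet F e | ∃ b, l.head? = some b ∧ S.red a b}.ncard =
        (S.wordSet F e).ncard := by
      rw [← Set.ncard_union_eq _ (hfin.subset fun _ h => h.1) (hfin.subset fun _ h => h.1)]
      · congr 1
        ext l
        simp only [Set.mem_union, Set.mem_ofPred_eq]
        tauto
      · rw [Set.disjoint_left]
        exact fun l h h' => h.2 h'.2
    rw [wordSeries, coeff_mk, ← h₃, h₁, h₂, map_sum]
    push_cast
    congr 1
    refine Finset.sum_congr rfl fun b _ => ?_
    split_ifs
    · rw [headSeries, coeff_mk]
    · rw [map_zero]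
  · have : {l ∈ S.wordSet F d | l.head? = some a} = ∅ := by
      ext l
      simp only [Set.mem_ofPred_eq, Set.mem_empty_iff_false, iff_false, not_and]
      rintro ⟨-, hl, -⟩ h'
      cases l with
      | nil => simp at h'
      | cons b l =>
        obtain rfl : b = a := by simpa using h'
        rw [wdeg_cons] at hl
        omega
    rw [this, Set.ncard_empty, Nat.cast_zero, add_zero]

end QuadraticRewriting

/-! ### A triangular system on a Boolean lattice. -/

namespace PowerSeries

variable {R : Type*} [CommRing R]

theorem one_sub_X_mul_geom (n : ℕ) :
    (1 - X) * ∑ i ∈ Finset.range n, (X : R⟦X⟧) ^ (i + 1) = X * (1 - X ^ n) := by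
  simp only [pow_succ']
  rw [← Finset.mul_sum, mul_left_comm, mul_neg_geom_sum]

/-- The solution of a triangular system of equations indexed by the subsets of a finite set `Q` with
weights `s`. -/
theorem mul_one_sub_prod_of_powerset {Q : Type*} [Fintype Q] [DecidableEq Q] (s : Q → ℕ)
    (y : Finset Q → R⟦X⟧) (H : R⟦X⟧) (hH : H = 1 + ∑ T, y T)
    (hy : ∀ U : Finset Q, ∑ T ∈ U.powerset, X ^ (∑ c ∈ U \ T, s c) * y T =
      (∑ i ∈ Finset.range (∑ c ∈ U, s c), X ^ (i + 1)) * H) :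
    H * (1 - X * ∏ c, (2 - X ^ s c)) = 1 - X := by
  -- The claimed solution, multiplied by $1-t$ so that nothing has to be inverted. The correction at
  -- the empty set makes that term zero.
  have key : ∀ U : Finset Q, (1 - X) * y U =
      X * H * ∏ c ∈ U, (1 - X ^ s c) - if U = ∅ then X * H else 0 := by
    intro U
    induction U using Finset.strongInduction with
    | H U ih =>
    have h₁ := congrArg (fun f => (1 - X) * f) (hy U)
    simp only [← mul_assoc, one_sub_X_mul_geom] at h₁
    rw [Finset.mul_sum] at h₁
    -- The claimed solution satisfies the same equations, since $\prod_{c\in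
    -- U}((1-t^{s_c})+t^{s_c})=1$. The terms with $T\ne U$ then agree by induction.
    have h₂ : ∑ T ∈ U.powerset, X ^ (∑ c ∈ U \ T, s c) *
        (X * H * ∏ c ∈ T, (1 - X ^ s c) - if T = ∅ then X * H else 0) =
        X * (1 - X ^ (∑ c ∈ U, s c)) * H := by
      simp only [mul_sub, mul_ite, mul_zero, Finset.sum_sub_distrib]
      rw [Finset.sum_ite_eq' U.powerset ∅, if_pos (Finset.empty_mem_powerset U), Finset.sdiff_empty]
      have : ∑ T ∈ U.powerset, X ^ (∑ c ∈ U \ T, s c) * (X * H * ∏ c ∈ T, (1 - (X : R⟦X⟧) ^ s c)) =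
          X * H * ∏ c ∈ U, ((1 - X ^ s c) + X ^ s c) := by
        rw [Finset.prod_add, Finset.mul_sum]
        refine Finset.sum_congr rfl fun T _ => ?_
        rw [Finset.prod_pow_eq_pow_sum]
        ring
      rw [this]
      simp
      ring
    rw [← h₂, ← Finset.add_sum_erase _ _ (Finset.mem_powerset_self U),
      ← Finset.add_sum_erase _ _ (Finset.mem_powerset_self U)] at h₁
    have h₃ : ∑ T ∈ U.powerset.erase U, (1 - X) * (X ^ (∑ c ∈ U \ T, s c) * y T) =
        ∑ T ∈ U.powerset.erase U, X ^ (∑ c ∈ U \ T, s c) *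
          (X * H * ∏ c ∈ T, (1 - X ^ s c) - if T = ∅ then X * H else 0) := by
      refine Finset.sum_congr rfl fun T hT => ?_
      obtain ⟨hne, hT⟩ := Finset.mem_erase.1 hT
      rw [mul_left_comm, ih T (Finset.ssubset_iff_subset_ne.2 ⟨Finset.mem_powerset.1 hT, hne⟩)]
    simp only [mul_assoc] at h₁ h₃ ⊢
    rw [h₃] at h₁
    simpa using add_right_cancel h₁
  have h := congrArg (fun f => (1 - X) * f) hH
  simp only [mul_add, mul_one, Finset.mul_sum, key, Finset.sum_sub_distrib] at h
  rw [Finset.sum_ite_eq' Finset.univ ∅, if_pos (Finset.mem_univ _), ← Finset.mul_sum,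
    ← Finset.powerset_univ, ← Finset.prod_one_add] at h
  have e : ∏ c, (1 + (1 - (X : R⟦X⟧) ^ s c)) = ∏ c, (2 - X ^ s c) :=
    Finset.prod_congr rfl fun c _ => by ring
  rw [e] at h
  linear_combination h

end PowerSeries

/-! ### Invariant subsets as unions of cycles. -/

namespace Equiv.Perm

variable {α : Type*} (σ : Equiv.Perm α)

/-- The cycles of a permutation, fixed points included. -/
abbrev Cycles : Type _ := Quotient (SameCycle.setoid σ)

variable {σ} in
theorem mk_eq_mk_iff {x y : α} :
    (Quotient.mk (SameCycle.setoid σ) x) = Quotient.mk (SameCycle.setoid σ) y ↔ SameCycle σ x y :=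
  Quotient.eq

variable [Fintype α]

open Classical in
/-- The union of a set of cycles. -/
noncomputable def unionCycles (S : Finset σ.Cycles) : Finset α :=
  Finset.univ.filter fun x => Quotient.mk (SameCycle.setoid σ) x ∈ S

variable {σ} in
theorem mem_unionCycles {S : Finset σ.Cycles} {x : α} :
    x ∈ σ.unionCycles S ↔ Quotient.mk (SameCycle.setoid σ) x ∈ S := by
  simp [unionCycles]

theorem unionCycles_subset_iff {S T : Finset σ.Cycles} :
    σ.unionCycles S ⊆ σ.unionCycles T ↔ S ⊆ T := by
  refine ⟨fun h c => ?_, fun h x => ?_⟩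
  · induction c using Quotient.inductionOn with
    | h x => simpa only [mem_unionCycles] using @h x
  · simpa only [mem_unionCycles] using @h _

theorem unionCycles_injective : Function.Injective σ.unionCycles := fun _ _ h =>
  ((σ.unionCycles_subset_iff).1 h.subset).antisymm ((σ.unionCycles_subset_iff).1 h.superset)

theorem map_unionCycles (S : Finset σ.Cycles) :
    (σ.unionCycles S).map σ.toEmbedding = σ.unionCycles S := by
  refine Finset.eq_of_subset_of_card_le (fun y hy => ?_) (Finset.card_map _).ge
  obtain ⟨x, hx, rfl⟩ := Finset.mem_map.1 hy
  rw [mem_unionCycles] at hx ⊢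
  rwa [show Quotient.mk (SameCycle.setoid σ) (σ.toEmbedding x) = Quotient.mk _ x from
    mk_eq_mk_iff.2 (sameCycle_apply_left.2 (SameCycle.refl σ x))]

theorem exists_unionCycles {A : Finset α} (hA : A.map σ.toEmbedding = A) :
    ∃ S, σ.unionCycles S = A := by
  classical
  refine ⟨A.image (Quotient.mk (SameCycle.setoid σ)), ?_⟩
  ext x
  rw [mem_unionCycles, Finset.mem_image]
  refine ⟨?_, fun hx => ⟨x, hx, rfl⟩⟩
  rintro ⟨y, hy, h⟩
  have hmem : ∀ z, z ∈ A ↔ σ z ∈ A := fun z => by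
    conv_rhs => rw [← hA]
    simp
  have : ∀ z, z ∈ A → ∀ n : ℕ, (σ ^ n) z ∈ A := fun z hz n => by
    induction n with
    | zero => simpa using hz
    | succ n ih =>
      rw [pow_succ', mul_apply]
      exact (hmem _).1 ih
  obtain ⟨n, hn⟩ := SameCycle.exists_nat_pow_eq (mk_eq_mk_iff.1 h)
  exact hn ▸ this y hy n

open Classical in
/-- The length of a cycle. -/
noncomputable def cycleLength (c : σ.Cycles) : ℕ :=
  (Finset.univ.filter fun x => Quotient.mk (SameCycle.setoid σ) x = c).card

theorem card_unionCycles (S : Finset σ.Cycles) :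
    (σ.unionCycles S).card = ∑ c ∈ S, σ.cycleLength c := by
  classical
  rw [Finset.card_eq_sum_card_fiberwise (f := Quotient.mk (SameCycle.setoid σ)) (t := S)
    fun x hx => mem_unionCycles.1 hx]
  refine Finset.sum_congr rfl fun c hc => ?_
  rw [cycleLength]
  congr 1
  ext x
  simp only [Finset.mem_filter, mem_unionCycles, Finset.mem_univ, true_and, and_iff_right_iff_imp]
  rintro rfl
  exact hc

theorem cycleLength_of_fixed {x : α} (hx : σ x = x) : σ.cycleLength (Quotient.mk _ x) = 1 := by
  classical
  rw [cycleLength, Finset.card_eq_one]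
  refine ⟨x, ?_⟩
  ext y
  rw [Finset.mem_filter, mk_eq_mk_iff, Finset.mem_singleton]
  refine ⟨fun h => ?_, fun h => ⟨Finset.mem_univ _, h ▸ SameCycle.refl σ _⟩⟩
  exact (h.2.symm.eq_of_left hx).symm

variable [DecidableEq α]

theorem cycleLength_eq_card_support {x : α} (hx : σ x ≠ x) :
    σ.cycleLength (Quotient.mk _ x) = (σ.cycleOf x).support.card := by
  classical
  rw [cycleLength]
  congr 1
  ext y
  rw [mem_support_cycleOf_iff, Finset.mem_filter, mk_eq_mk_iff, sameCycle_comm]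
  simp [hx]

/-- The parts are the lengths of nontrivial cycles together with a $1$ for each fixed point; the
product over cycles is split according to whether a representative is moved. -/
theorem prod_map_partition_parts {M : Type*} [CommMonoid M] (f : ℕ → M) [Fintype σ.Cycles] :
    (σ.partition.parts.map f).prod = ∏ c, f (σ.cycleLength c) := by
  classical
  have hout : ∀ c : σ.Cycles, Quotient.mk (SameCycle.setoid σ) c.out = c := Quotient.out_eq
  rw [parts_partition, Multiset.map_add, Multiset.prod_add, cycleType_def, Multiset.map_map,
    ← Finset.prod_filter_mul_prod_filter_not Finset.univ fun c : σ.Cycles => σ c.out ≠ c.out]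
  congr 1
  · symm
    refine Finset.prod_bij (fun c _ => σ.cycleOf c.out) (fun c hc => ?_) (fun c hc d hd h => ?_)
      (fun g hg => ?_) (fun c hc => ?_)
    · rw [cycleOf_mem_cycleFactorsFinset_iff, mem_support]
      exact (Finset.mem_filter.1 hc).2
    · have hm : c.out ∈ (σ.cycleOf d.out).support := by
        rw [← h, mem_support_cycleOf_iff]
        exact ⟨SameCycle.refl _ _, mem_support.2 (Finset.mem_filter.1 hc).2⟩
      rw [← hout c, ← hout d]
      exact (mk_eq_mk_iff.2 (mem_support_cycleOf_iff.1 hm).1).symm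
    · obtain ⟨x, hx⟩ := (mem_cycleFactorsFinset_iff.1 hg).1.nonempty_support
      have hxs : σ x ≠ x := mem_support.1 (mem_cycleFactorsFinset_support_le hg hx)
      have hs : SameCycle σ (Quotient.mk (SameCycle.setoid σ) x).out x :=
        mk_eq_mk_iff.1 (hout _)
      refine ⟨Quotient.mk _ x, Finset.mem_filter.2 ⟨Finset.mem_univ _, ?_⟩, ?_⟩
      · intro h
        exact hxs (hs.eq_of_left h ▸ h)
      · rw [hs.cycleOf_eq, ← cycle_is_cycleOf hx hg]
    · conv_lhs => rw [← hout c]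
      rw [cycleLength_eq_card_support _ (Finset.mem_filter.1 hc).2]
      rfl
  · rw [Multiset.map_replicate, Multiset.prod_replicate]
    have h1 : ∀ c ∈ Finset.univ.filter (fun c : σ.Cycles => ¬ σ c.out ≠ c.out),
        f (σ.cycleLength c) = f 1 := fun c hc => by
      conv_lhs => rw [← hout c]
      rw [cycleLength_of_fixed _ (not_not.1 (Finset.mem_filter.1 hc).2)]
    rw [Finset.prod_congr rfl h1, Finset.prod_const]
    congr 1
    rw [← Finset.card_compl]
    symm
    refine Finset.card_bij (fun c _ => c.out) (fun c hc => ?_) (fun c _ d _ h => ?_) (fun x hx => ?_)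
    · simpa using hc
    · rw [← hout c, ← hout d, h]
    · have hxs : σ x = x := by simpa using hx
      have hs : SameCycle σ x (Quotient.mk (SameCycle.setoid σ) x).out :=
        (mk_eq_mk_iff.1 (hout _)).symm
      have := hs.eq_of_left hxs
      refine ⟨Quotient.mk _ x, ?_, this.symm⟩
      rw [Finset.mem_filter, ← this]
      simpa using hxs

end Equiv.Perm

/-! ### The lattice of subsets. -/

namespace subsetGraph

open LayeredGraph PowerSeries RankLetter QuadraticRewriting

theorem le_iff {n : ℕ} {u v : Finset (Fin n)} : LE.le (α := (subsetGraph n).V) u v ↔ u ⊆ v := by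
  constructor
  · rintro ⟨π, hπ⟩
    induction π generalizing v with
    | nil => exact (show v = u from hπ) ▸ subset_rfl
    | cons e π ih =>
      obtain ⟨rfl, h⟩ := hπ
      exact (ih h).trans (Finset.erase_subset _ _)
  · intro h
    induction hd : (v \ u).card generalizing v with
    | zero =>
      exact ⟨[], (Finset.sdiff_eq_empty_iff_subset.1 (Finset.card_eq_zero.1 hd)).antisymm h⟩
    | succ m ih =>
      obtain ⟨i, hi⟩ := Finset.card_pos.1 (by rw [hd]; omega)
      obtain ⟨hiv, hiu⟩ := Finset.mem_sdiff.1 hi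
      obtain ⟨π, hπ⟩ := ih (v := v.erase i)
        (fun x hx => Finset.mem_erase.2 ⟨fun e => hiu (e ▸ hx), h hx⟩) (by
          rw [Finset.erase_sdiff_comm, Finset.card_erase_of_mem hi, hd, Nat.add_sub_cancel])
      exact ⟨⟨(v, i), hiv⟩ :: π, rfl, hπ⟩

theorem lt_iff_ssubset {n : ℕ} {u v : Finset (Fin n)} :
    LT.lt (α := (subsetGraph n).V) u v ↔ u ⊂ v :=
  lt_iff_le_not_ge.trans (and_congr le_iff (not_congr le_iff))

/-- The letters `(A, i)` for subsets `A` of an `n`-element set. -/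
abbrev Letter (n : ℕ) : Type := RankLetter (subsetGraph n).level

instance (n : ℕ) : Fintype (subsetGraph n).V := inferInstanceAs (Fintype (Finset (Fin n)))

variable (k : Type*) [Field k] {n : ℕ} (σ : Equiv.Perm (Fin n)) (R : Type*) [CommRing R]

/-- The subset at which a letter is placed. -/
def Letter.set (a : Letter n) : Finset (Fin n) := a.1.1

theorem red_iff {a b : Letter n} :
    (system k (subsetGraph n).level).red a b ↔
      b.set ⊂ a.set ∧ a.set.card = b.set.card + a.1.2 :=
  and_congr_left fun _ => lt_iff_ssubset

/-- The letters fixed by `σ`. -/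
def IsFixed (a : Letter n) : Prop := a.set.map σ.toEmbedding = a.set

/-- The generating function of the irreducible fixed words with first letter `(A, i)`. -/
noncomputable def firstSeries (A : Finset (Fin n)) (i : ℕ) : R⟦X⟧ :=
  if h : 1 ≤ i ∧ i ≤ A.card then
    (system k (subsetGraph n).level).headSeries (IsFixed σ) R ⟨(A, i), h⟩
  else 0

theorem firstSeries_letter (b : Letter n) :
    firstSeries k σ R b.set b.1.2 =
      (system k (subsetGraph n).level).headSeries (IsFixed σ) R b :=
  dif_pos (c := 1 ≤ b.1.2 ∧ b.1.2 ≤ b.set.card) b.2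

/-- The generating function of the irreducible fixed words with first letter at `A`. -/
noncomputable def vertexSeries (A : Finset (Fin n)) : R⟦X⟧ :=
  ∑ i ∈ Finset.range (n + 1), firstSeries k σ R A i

noncomputable instance : Fintype (Letter n) := Fintype.ofFinite _

open Classical in
theorem sum_headSeries (P : Finset (Fin n) → Prop) :
    ∑ b : Letter n, (if P b.set then
      (system k (subsetGraph n).level).headSeries (IsFixed σ) R b else 0) =
    ∑ A, if P A then vertexSeries k σ R A else 0 := by
  let f : Finset (Fin n) × ℕ → R⟦X⟧ := fun p =>
    if P p.1 then firstSeries k σ R p.1 p.2 else 0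
  have h₁ : ∀ p : Finset (Fin n) × ℕ,
      p ∈ ((Finset.univ ×ˢ Finset.range (n + 1) : Finset (Finset (Fin n) × ℕ)).filter
        fun p => 1 ≤ p.2 ∧ p.2 ≤ p.1.card) ↔ 1 ≤ p.2 ∧ p.2 ≤ p.1.card := fun p => by
    have := Finset.card_le_univ p.1
    rw [Fintype.card_fin] at this
    simp only [Finset.mem_filter, Finset.mem_product, Finset.mem_univ, Finset.mem_range, true_and,
      and_iff_right_iff_imp]
    omega
  have h₂ : ∀ b : Letter n, (if P b.set then
      (system k (subsetGraph n).level).headSeries (IsFixed σ) R b else 0) = f b.1 := fun b =>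
    if_congr Iff.rfl (firstSeries_letter k σ R b).symm rfl
  rw [Finset.sum_congr rfl fun b _ => h₂ b]
  refine (Finset.sum_subtype _ h₁ f).symm.trans ?_
  rw [Finset.sum_filter_of_ne, Finset.sum_product]
  · refine Finset.sum_congr rfl fun A _ => ?_
    simp only [f]
    split_ifs
    · rfl
    · exact Finset.sum_const_zero
  · intro p _ hp
    by_contra h
    exact hp (by simp only [f, firstSeries, dif_neg h, ite_self])

theorem wordSeries_eq_sum :
    (system k (subsetGraph n).level).wordSeries (IsFixed σ) R =
      1 + ∑ A, vertexSeries k σ R A := by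
  rw [wordSeries_eq (S := system k (subsetGraph n).level) (fun a => a.2.1)]
  have := sum_headSeries k σ R fun _ => True
  simp only [if_true] at this
  rw [← this]

theorem vertexSeries_eq_zero {A : Finset (Fin n)} (hA : A.map σ.toEmbedding ≠ A) :
    vertexSeries k σ R A = 0 := by
  refine Finset.sum_eq_zero fun i _ => ?_
  rw [firstSeries]
  split_ifs with h
  · exact headSeries_eq_zero (S := system k (subsetGraph n).level) (F := IsFixed σ)
      (a := ⟨(A, i), h⟩) hA R
  · rfl

-- Whether $(A,i+1)(B,j)$ is reducible does not depend on $j$, so the letters at $B$ may be summed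
-- into one series.
open Classical in
theorem firstSeries_add {A : Finset (Fin n)} (hA : A.map σ.toEmbedding = A) {i : ℕ}
    (hi : i < A.card) :
    firstSeries k σ R A (i + 1) + ∑ B, (if B ⊂ A ∧ A.card = B.card + (i + 1) then
        X ^ (i + 1) * vertexSeries k σ R B else 0) =
      X ^ (i + 1) * (system k (subsetGraph n).level).wordSeries (IsFixed σ) R := by
  have h : 1 ≤ i + 1 ∧ i + 1 ≤ A.card := by omega
  have := headSeries_add (S := system k (subsetGraph n).level) (F := IsFixed σ) (fun a => a.2.1)
    (a := ⟨(A, i + 1), h⟩) hA R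
  have e := sum_headSeries k σ R fun B => B ⊂ A ∧ A.card = B.card + (i + 1)
  have e' : ∑ B, (if B ⊂ A ∧ A.card = B.card + (i + 1) then
        X ^ (i + 1) * vertexSeries k σ R B else 0) = X ^ (i + 1) *
      ∑ B, (if B ⊂ A ∧ A.card = B.card + (i + 1) then vertexSeries k σ R B else 0) := by
    rw [Finset.mul_sum]
    simp only [mul_ite, mul_zero]
  rw [firstSeries, dif_pos h, e']
  refine (congrArg₂ (· + ·) rfl (congrArg₂ (· * ·) rfl ?_)).trans this
  refine Eq.trans ?_ (e.symm.trans (Finset.sum_congr rfl fun b _ => ?_))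
  · exact Finset.sum_congr rfl fun B _ => by congr
  · have hr : (system k (subsetGraph n).level).red ⟨(A, i + 1), h⟩ b ↔
        b.set ⊂ A ∧ A.card = b.set.card + (i + 1) := red_iff k
    by_cases hb : b.set ⊂ A ∧ A.card = b.set.card + (i + 1)
    · rw [if_pos hb, if_pos (hr.2 hb)]
    · rw [if_neg hb, if_neg (mt hr.1 hb)]

/-- The equations for the letters $(A,1),\dots,(A,|A|)$ are added; a proper subset $B$ occurs only
in the one with $i=|A|-|B|$. -/
theorem sum_powerset_vertexSeries {A : Finset (Fin n)} (hA : A.map σ.toEmbedding = A) :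
    ∑ B ∈ A.powerset, X ^ (A.card - B.card) * vertexSeries k σ R B =
      (∑ i ∈ Finset.range A.card, X ^ (i + 1)) *
        (system k (subsetGraph n).level).wordSeries (IsFixed σ) R := by
  classical
  have hc := Finset.card_le_univ A
  rw [Fintype.card_fin] at hc
  have h₁ : vertexSeries k σ R A = ∑ i ∈ Finset.range A.card, firstSeries k σ R A (i + 1) := by
    have h0 : firstSeries k σ R A 0 = 0 := by rw [firstSeries, dif_neg (by omega)]
    rw [vertexSeries, Finset.sum_range_succ', h0, add_zero]
    symm
    refine Finset.sum_subset (Finset.range_subset_range.2 hc) fun i _ hi => ?_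
    rw [Finset.mem_range] at hi
    rw [firstSeries, dif_neg (by omega)]
  rw [← Finset.add_sum_erase _ _ (Finset.mem_powerset_self A), Nat.sub_self, pow_zero, one_mul,
    Finset.sum_mul, h₁]
  have h₂ : ∑ B ∈ A.powerset.erase A, X ^ (A.card - B.card) * vertexSeries k σ R B =
      ∑ i ∈ Finset.range A.card, ∑ B, if B ⊂ A ∧ A.card = B.card + (i + 1) then
        X ^ (i + 1) * vertexSeries k σ R B else 0 := by
    rw [Finset.sum_comm]
    have : A.powerset.erase A = Finset.univ.filter fun B => B ⊂ A := by
      ext B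
      simp [Finset.ssubset_iff_subset_ne, and_comm]
    rw [this, Finset.sum_filter]
    refine Finset.sum_congr rfl fun B _ => ?_
    split_ifs with hB
    · have hlt := Finset.card_lt_card hB
      rw [Finset.sum_eq_single (A.card - B.card - 1)]
      · rw [if_pos ⟨hB, by omega⟩]
        congr 2
        omega
      · intro i _ hi
        rw [if_neg]
        rintro ⟨-, h⟩
        omega
      · intro h
        rw [Finset.mem_range] at h
        omega
    · exact (Finset.sum_eq_zero fun i _ => if_neg fun h => hB h.1).symm
  rw [h₂, ← Finset.sum_add_distrib]
  exact Finset.sum_congr rfl fun i hi => firstSeries_add k σ R hA (Finset.mem_range.1 hi)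

/-- The generating function of the irreducible words fixed by `σ`. -/
theorem wordSeries_mul :
    (system k (subsetGraph n).level).wordSeries (IsFixed σ) R *
      (1 - X * (σ.partition.parts.map fun i => 2 - (X : R⟦X⟧) ^ i).prod) = 1 - X := by
  classical
  have : Fintype σ.Cycles := Fintype.ofFinite _
  rw [Equiv.Perm.prod_map_partition_parts]
  have hinj := σ.unionCycles_injective
  -- The series vanishes at subsets not fixed by `σ`, so all sums reduce to unions of cycles, which
  -- form the Boolean lattice on the set of cycles.
  refine mul_one_sub_prod_of_powerset σ.cycleLength
    (fun S => vertexSeries k σ R (σ.unionCycles S)) _ ?_ fun U => ?_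
  · rw [wordSeries_eq_sum]
    congr 1
    rw [← Finset.sum_image (f := vertexSeries k σ R) (g := σ.unionCycles) hinj.injOn]
    symm
    refine Finset.sum_subset (Finset.subset_univ _) fun A _ hA => vertexSeries_eq_zero k σ R ?_
    intro h
    obtain ⟨S, hS⟩ := σ.exists_unionCycles h
    exact hA (Finset.mem_image.2 ⟨S, Finset.mem_univ _, hS⟩)
  · have := sum_powerset_vertexSeries k σ R (σ.map_unionCycles U)
    rw [σ.card_unionCycles] at this
    rw [← this]
    have h₁ : ∀ T ∈ U.powerset, X ^ (∑ c ∈ U \ T, σ.cycleLength c) *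
        vertexSeries k σ R (σ.unionCycles T) =
        X ^ (∑ c ∈ U, σ.cycleLength c - (σ.unionCycles T).card) *
        vertexSeries k σ R (σ.unionCycles T) := fun T hT => by
      rw [σ.card_unionCycles, ← Finset.sum_sdiff (Finset.mem_powerset.1 hT),
        Nat.add_sub_cancel]
    rw [Finset.sum_congr rfl h₁, ← Finset.sum_image
      (f := fun B => X ^ (∑ c ∈ U, σ.cycleLength c - B.card) * vertexSeries k σ R B)
      (g := σ.unionCycles) hinj.injOn]
    refine Finset.sum_subset (fun B hB => ?_) fun B hB hB' => ?_
    · obtain ⟨T, hT, rfl⟩ := Finset.mem_image.1 hB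
      exact Finset.mem_powerset.2 ((σ.unionCycles_subset_iff).2 (Finset.mem_powerset.1 hT))
    · rw [vertexSeries_eq_zero, mul_zero]
      intro h
      obtain ⟨T, rfl⟩ := σ.exists_unionCycles h
      refine hB' (Finset.mem_image.2 ⟨T, Finset.mem_powerset.2 ?_, rfl⟩)
      exact (σ.unionCycles_subset_iff).1 (Finset.mem_powerset.1 hB)

theorem gradedTrace_eq :
    gradedTrace k (subsetGraph n) (subsetGraphAut σ) =
      (system k (subsetGraph n).level).wordSeries (IsFixed σ) k := by
  ext d
  rw [gradedTrace, coeff_mk, Aut.trace_onComponent, wordSeries, coeff_mk]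
  rfl

theorem hilbertSeries_eq :
    hilbertSeries k (subsetGraph n) =
      (system k (subsetGraph n).level).wordSeries (IsFixed (1 : Equiv.Perm (Fin n))) ℚ := by
  ext d
  rw [hilbertSeries, coeff_mk, finrank_component, wordSeries, coeff_mk, ← Nat.card_coe_set_eq]
  congr 1
  refine Nat.card_congr (Equiv.subtypeEquivRight fun l => ?_)
  have : ∀ a : Letter n, IsFixed (1 : Equiv.Perm (Fin n)) a := fun a => Finset.map_refl
  simp [wordSet, this]

end subsetGraph

theorem theoremT (k : Type*) [Field k] (n : ℕ) (σ : Equiv.Perm (Fin n)) :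
    (∀ d : ℕ, Module.Finite k (LayeredGraph.component k (subsetGraph n) d)) ∧
    LayeredGraph.gradedTrace k (subsetGraph n) (subsetGraphAut σ) =
      (1 - PowerSeries.X) *
        (1 - PowerSeries.X *
          (σ.partition.parts.map fun i => 2 - (PowerSeries.X : PowerSeries k) ^ i).prod)⁻¹ ∧
    LayeredGraph.hilbertSeries k (subsetGraph n) =
      (1 - PowerSeries.X) *
        (1 - PowerSeries.X * (2 - (PowerSeries.X : PowerSeries ℚ)) ^ n)⁻¹ := by
  refine ⟨LayeredGraph.finite_component k, ?_, ?_⟩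
  · rw [PowerSeries.eq_mul_inv_iff_mul_eq (by simp), subsetGraph.gradedTrace_eq,
      subsetGraph.wordSeries_mul]
  · rw [PowerSeries.eq_mul_inv_iff_mul_eq (by simp), subsetGraph.hilbertSeries_eq]
    have := subsetGraph.wordSeries_mul k (1 : Equiv.Perm (Fin n)) ℚ
    -- The identity has empty cycle type and `n` fixed points, so the product becomes $(2-t)^n$.
    rw [Equiv.Perm.parts_partition] at this
    simpa using this
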